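/- **Conventions.** Let $M$ be a smooth manifold of odd dimension. For a bivector $P$ and a 2-form $\sigma$ on $M$ let $P^\sharp:T^*M\to TM$ and $\sigma^\flat:TM\to T^*M$ be given by $\beta(P^\sharp\alpha)=P(\alpha,\beta)$ and $\sigma^\flat(X)(Y)=\sigma(X,Y)$; for a bundle map $F:TM\to TM$ let $F^*\alpha=\alpha\circ F$. The Courant bracket on sections of $TM\oplus T^*M$ is $$[\![X+\alpha,Y+\beta]\!]=[X,Y]+L_X\beta-L_Y\alpha-\tfrac12 d(\beta(X)-\alpha(Y)).$$ A *generalized almost para-contact structure* on $M$ consists of smooth tensor fields $(F,P,\sigma,Z,\xi)$, where $F:TM\to TM$ is a bundle map, $P$ a bivector, $\sigma$ a 2-form, $Z$ a vector field and $\xi$ a 1-form, such that the (skew) bundle map $\mathcal F=\begin{pmatrix}F&P^\sharp\\ \sigma^\flat&-F^*\end{pmatrix}$ of $TM\oplus T^*M$ satisfies $\xi(Z)=1$, $\mathcal F(\xi)=0$, $\mathcal F(Z)=0$ and $\mathcal F^2(X+\alpha)=X+\alpha-\xi(X)Z-\alpha(Z)\xi$. Its $M$-adapted generalized almost para-complex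 structure on $M\times\mathbb R$ (with coordinate $t$ on $\mathbb R$) is $$\mathcal J=\begin{pmatrix}F&\pi^\sharp\\ \theta^\flat&-F^*\end{pmatrix},\qquad \pi=P-Z\wedge\tfrac{d}{dt},\quad \theta=\sigma+\xi\wedge dt,$$ where $F$ is extended by $F(\frac{d}{dt})=0$; it is skew for the natural pairing and $\mathcal J^2=I$. (The choice $\pi=P+Z\wedge\frac{d}{dt}$, $\theta=\sigma-\xi\wedge dt$ differs from it by the diffeomorphism $t\mapsto -t$.) The structure $(F,P,\sigma,Z,\xi)$ is *normal* if $\mathcal J$ is integrable, i.e. $[\![\mathcal Je_1,\mathcal Je_2]\!]-\mathcal J([\![\mathcal Je_1,e_2]\!]+[\![e_1,\mathcal Je_2]\!])+[\![e_1,e_2]\!]=0$ for all smooth sections $e_1,e_2$ of $T(M\times\mathbb R)\oplus T^*(M\times\mathbb R)$. Put $[\alpha,\beta]_P=L_{P^\sharp\alpha}\beta-L_{P^\sharp\beta}\alpha-d(P(\alpha,\beta))$, $N_F(X,Y)=[FX,FY]+F^2[X,Y]-F[FX,Y]-F[X,FY]$, $\sigma_F(X,Y)=\sigma(FX,Y)$,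 $i_{X\wedge Y}d\sigma=d\sigma(X,Y,\cdot)$ and $d\xi(X,Y)=X(\xi(Y))-Y(\xi(X))-\xi([X,Y])$. **Theorem 3.1.** A generalized almost para-contact structure $(F,P,\sigma,Z,\xi)$ on $M$ is normal if and only if the following conditions hold for all smooth vector fields $X,Y,W$ and 1-forms $\alpha,\beta$ on $M$: - (A1) $[P^\sharp\alpha,P^\sharp\beta]=P^\sharp([\alpha,\beta]_P)$. - (A2) $FP^\sharp=P^\sharp F^*$ and $F^*([\alpha,\beta]_P)=L_{P^\sharp\alpha}F^*\beta-L_{P^\sharp\beta}F^*\alpha+d(P(\beta,F^*\alpha))$. - (A3) $i_Z\sigma=0$, $i_\xi P=0$, $F^2=\mathrm{Id}-P^\sharp\sigma^\flat-Z\otimes\xi$, and $N_F(X,Y)=P^\sharp(i_{X\wedge Y}d\sigma)+d\xi(X,Y)\,Z$. - (A4) $F(Z)=0$, $\xi\circ F=0$, $(L_{FX}\xi)(Y)-(L_{FY}\xi)(X)=0$, and $d\sigma_F(X,Y,W)=d\sigma(FX,Y,W)+d\sigma(X,FY,W)+d\sigma(X,Y,FW)$. - (A5) $L_Z\xi=0$,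 $L_ZP=0$, $L_ZF=0$, $L_Z\sigma^\flat=0$, and $L_{P^\sharp\alpha}\xi=0$. -/

import Mathlib

open scoped Manifold ContDiff
open VectorField

noncomputable section

namespace ParaContact

section Calculus

variable {E : Type*} [NormedAddCommGroup E] [NormedSpace ℝ E]
  {H : Type*} [TopologicalSpace H] (I : ModelWithCorners ℝ E H)
  {M : Type*} [TopologicalSpace M] [ChartedSpace H M]

/-- The cotangent space `T*ₓM`. -/
abbrev Cotangent (x : M) : Type _ := TangentSpace I x →L[ℝ] ℝ

/-- The fibre at `x` of the big tangent bundle `TM ⊕ T*M`. -/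
abbrev BigTangent (x : M) : Type _ := TangentSpace I x × Cotangent I x

/-! ### Smooth sections -/

section Smooth

variable [IsManifold I ∞ M]

/-- `X` is a smooth vector field. -/
def SmoothVectorField (X : Π x : M, TangentSpace I x) : Prop :=
  ContMDiff I (I.prod 𝓘(ℝ, E)) ∞
    (fun x ↦ Bundle.TotalSpace.mk' E (E := fun x : M ↦ TangentSpace I x) x (X x))

/-- `α` is a smooth 1-form: a smooth section of the bundle `Hom(TM, ℝ)`. -/
def SmoothOneForm (α : Π x : M, Cotangent I x) : Prop :=
  ContMDiff I (I.prod 𝓘(ℝ, E →L[ℝ] ℝ)) ∞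
    (fun x ↦ Bundle.TotalSpace.mk' (E →L[ℝ] ℝ) (E := fun x : M ↦ TangentSpace I x →L[ℝ] ℝ) x (α x))

/-- `F` is a smooth bundle map `TM → TM`. -/
def SmoothEndomorphism (F : Π x : M, TangentSpace I x →L[ℝ] TangentSpace I x) : Prop :=
  ContMDiff I (I.prod 𝓘(ℝ, E →L[ℝ] E)) ∞
    (fun x ↦ Bundle.TotalSpace.mk' (E →L[ℝ] E)
      (E := fun x : M ↦ TangentSpace I x →L[ℝ] TangentSpace I x) x (F x))

/-- `P` is a smooth bundle map `T*M → TM`. -/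
def SmoothSharp (P : Π x : M, Cotangent I x →L[ℝ] TangentSpace I x) : Prop :=
  ContMDiff I (I.prod 𝓘(ℝ, (E →L[ℝ] ℝ) →L[ℝ] E)) ∞
    (fun x ↦ Bundle.TotalSpace.mk' ((E →L[ℝ] ℝ) →L[ℝ] E)
      (E := fun x : M ↦ (TangentSpace I x →L[ℝ] ℝ) →L[ℝ] TangentSpace I x) x (P x))

/-- `σ` is a smooth bundle map `TM → T*M`. -/
def SmoothFlat (σ : Π x : M, TangentSpace I x →L[ℝ] Cotangent I x) : Prop :=
  ContMDiff I (I.prod 𝓘(ℝ, E →L[ℝ] E →L[ℝ] ℝ)) ∞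
    (fun x ↦ Bundle.TotalSpace.mk' (E →L[ℝ] E →L[ℝ] ℝ)
      (E := fun x : M ↦ TangentSpace I x →L[ℝ] TangentSpace I x →L[ℝ] ℝ) x (σ x))

/-- `e = (X, α)` is a smooth section of `TM ⊕ T*M`. -/
def SmoothSection (e : Π x : M, BigTangent I x) : Prop :=
  SmoothVectorField I (fun x ↦ (e x).1) ∧ SmoothOneForm I (fun x ↦ (e x).2)

end Smooth

/-! ### Exterior derivative and Lie derivative

The differential of a function `f` is Mathlib's `mvfderiv I f`, the Lie bracket of vector fields is
`mlieBracket I`.  The exterior derivatives of 1-forms and 2-forms are computed in the preferred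
chart `φ` at the point: pull the form back by `φ⁻¹`, differentiate and antisymmetrize in the model
space, and pull back by `φ`. -/

/-- The differential at `x` of the preferred chart at `x`. -/
def chartDeriv (x : M) : TangentSpace I x →L[ℝ] E :=
  mfderiv I 𝓘(ℝ, E) (extChartAt I x) x

/-- The differential at `y : E` of the inverse of the preferred chart at `x₀`. -/
def chartSymmDeriv (x₀ : M) (y : E) : E →L[ℝ] TangentSpace I ((extChartAt I x₀).symm y) :=
  mfderivWithin 𝓘(ℝ, E) I (extChartAt I x₀).symm (Set.range I) y

/-- The 1-form `α` read in the preferred chart at `x₀`. -/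
def chartOneForm (α : Π x : M, Cotangent I x) (x₀ : M) (y : E) : E →L[ℝ] ℝ :=
  (α ((extChartAt I x₀).symm y)).comp (chartSymmDeriv I x₀ y)

/-- The bilinear form `b` read in the preferred chart at `x₀`. -/
def chartTwoForm (b : Π x : M, TangentSpace I x →L[ℝ] Cotangent I x) (x₀ : M) (y : E) :
    E →L[ℝ] E →L[ℝ] ℝ :=
  (ContinuousLinearMap.precomp ℝ (chartSymmDeriv I x₀ y)).comp
    ((b ((extChartAt I x₀).symm y)).comp (chartSymmDeriv I x₀ y))

/-- The contracted exterior derivative of a 1-form: `extDerivOne I α x u` is the covector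
`dα(u, ·)` at `x`, where `dα(u, v) = ∂_u α(v) - ∂_v α(u)` in a chart. -/
def extDerivOne (α : Π x : M, Cotangent I x) (x : M) (u : TangentSpace I x) : Cotangent I x :=
  let D : E →L[ℝ] E →L[ℝ] ℝ :=
    fderivWithin ℝ (chartOneForm I α x) (Set.range I) (extChartAt I x x)
  (D (chartDeriv I x u) - D.flip (chartDeriv I x u)).comp (chartDeriv I x)

/-- The contracted exterior derivative of a 2-form: `extDerivTwo I σ x u v` is the covector
`dσ(u, v, ·)` at `x` (also written `i_{u ∧ v} dσ`), where
`dσ(u, v, w) = ∂_u σ(v, w) + ∂_v σ(w, u) + ∂_w σ(u, v)` in a chart. -/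
def extDerivTwo (σ : Π x : M, TangentSpace I x →L[ℝ] Cotangent I x) (x : M)
    (u v : TangentSpace I x) : Cotangent I x :=
  let D : E →L[ℝ] E →L[ℝ] E →L[ℝ] ℝ :=
    fderivWithin ℝ (chartTwoForm I σ x) (Set.range I) (extChartAt I x x)
  let u' : E := chartDeriv I x u
  let v' : E := chartDeriv I x v
  (D u' v' + (D v').flip u' + (D.flip u').flip v').comp (chartDeriv I x)

/-- The Lie derivative of a 1-form, `L_X α = i_X dα + d(i_X α)`. -/
def lieOneForm (X : Π x : M, TangentSpace I x) (α : Π x : M, Cotangent I x) (x : M) :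
    Cotangent I x :=
  extDerivOne I α x (X x) + mvfderiv I (fun y ↦ α y (X y)) x

/-! ### The pairing, the Courant bracket and integrability -/

/-- The pairing `⟨X + α, Y + β⟩ = (β(X) + α(Y)) / 2`. -/
def pairing {x : M} (e₁ e₂ : BigTangent I x) : ℝ := (1 / 2) * (e₂.2 e₁.1 + e₁.2 e₂.1)

/-- The Courant bracket
`⟦X + α, Y + β⟧ = [X, Y] + L_X β - L_Y α - (1/2) d(β(X) - α(Y))`. -/
def courantBracket (e₁ e₂ : Π x : M, BigTangent I x) (x : M) : BigTangent I x :=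
  (mlieBracket I (fun y ↦ (e₁ y).1) (fun y ↦ (e₂ y).1) x,
    lieOneForm I (fun y ↦ (e₁ y).1) (fun y ↦ (e₂ y).2) x
      - lieOneForm I (fun y ↦ (e₂ y).1) (fun y ↦ (e₁ y).2) x
      - (1 / 2 : ℝ) • mvfderiv I (fun y ↦ (e₂ y).2 (e₁ y).1 - (e₁ y).2 (e₂ y).1) x)

/-- Courant-integrability of an (almost para-complex) bundle map `J` of `TM ⊕ T*M`:
`⟦J e₁, J e₂⟧ - J (⟦J e₁, e₂⟧ + ⟦e₁, J e₂⟧) + ⟦e₁, e₂⟧ = 0` for all smooth sections. -/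
def CourantIntegrable [IsManifold I ∞ M] (J : Π x : M, BigTangent I x →L[ℝ] BigTangent I x) : Prop :=
  ∀ e₁ e₂ : Π x : M, BigTangent I x, SmoothSection I e₁ → SmoothSection I e₂ → ∀ x : M,
    courantBracket I (fun y ↦ J y (e₁ y)) (fun y ↦ J y (e₂ y)) x
      - J x (courantBracket I (fun y ↦ J y (e₁ y)) e₂ x
          + courantBracket I e₁ (fun y ↦ J y (e₂ y)) x)
      + courantBracket I e₁ e₂ x = 0

/-- The endomorphism with block matrix `(F, P♯; σ♭, -F*)` of `TₓM ⊕ T*ₓM`, that is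
`(X, α) ↦ (F X + P♯ α, σ♭ X - F* α)` with `F* α = α ∘ F`. -/
def blockMap {x : M} (F : TangentSpace I x →L[ℝ] TangentSpace I x)
    (P : Cotangent I x →L[ℝ] TangentSpace I x) (σ : TangentSpace I x →L[ℝ] Cotangent I x) :
    BigTangent I x →L[ℝ] BigTangent I x :=
  (F.coprod P).prod (σ.coprod (-(ContinuousLinearMap.precomp ℝ F)))

@[simp] lemma blockMap_apply {x : M} (F : TangentSpace I x →L[ℝ] TangentSpace I x)
    (P : Cotangent I x →L[ℝ] TangentSpace I x) (σ : TangentSpace I x →L[ℝ] Cotangent I x)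
    (e : BigTangent I x) :
    blockMap I F P σ e = (F e.1 + P e.2, σ e.1 - e.2.comp F) := by
  rw [sub_eq_add_neg]
  rfl

/-- If `P` and `σ` are skew, the block map is skew for the pairing. -/
lemma blockMap_skew {x : M} (F : TangentSpace I x →L[ℝ] TangentSpace I x)
    (P : Cotangent I x →L[ℝ] TangentSpace I x) (σ : TangentSpace I x →L[ℝ] Cotangent I x)
    (hP : ∀ α β : Cotangent I x, β (P α) = -α (P β))
    (hσ : ∀ u v : TangentSpace I x, σ u v = -σ v u) (e₁ e₂ : BigTangent I x) :
    pairing I (blockMap I F P σ e₁) e₂ + pairing I e₁ (blockMap I F P σ e₂) = 0 := by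
  simp only [pairing, blockMap_apply, map_add, sub_apply,
    ContinuousLinearMap.comp_apply]
  rw [hP e₁.2 e₂.2, hσ e₁.1 e₂.1]
  ring

/-- The bracket of 1-forms `[α, β]_P = L_{P♯α} β - L_{P♯β} α - d(P(α, β))`,
where `P(α, β) = β(P♯ α)`. -/
def formBracket (P : Π x : M, Cotangent I x →L[ℝ] TangentSpace I x)
    (α β : Π x : M, Cotangent I x) (x : M) : Cotangent I x :=
  lieOneForm I (fun y ↦ P y (α y)) β x - lieOneForm I (fun y ↦ P y (β y)) α x
    - mvfderiv I (fun y ↦ β y (P y (α y))) x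

/-- The Nijenhuis tensor `N_F(X, Y) = [FX, FY] + F²[X, Y] - F[FX, Y] - F[X, FY]`. -/
def nijenhuis (F : Π x : M, TangentSpace I x →L[ℝ] TangentSpace I x)
    (X Y : Π x : M, TangentSpace I x) (x : M) : TangentSpace I x :=
  mlieBracket I (fun y ↦ F y (X y)) (fun y ↦ F y (Y y)) x + F x (F x (mlieBracket I X Y x))
    - F x (mlieBracket I (fun y ↦ F y (X y)) Y x) - F x (mlieBracket I X (fun y ↦ F y (Y y)) x)

/-- The Lie derivative of a bivector:
`(L_Z P)(α, β) = Z(P(α, β)) - P(L_Z α, β) - P(α, L_Z β)`, where `P(α, β) = β(P♯ α)`. -/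
def lieBivector (Z : Π x : M, TangentSpace I x)
    (P : Π x : M, Cotangent I x →L[ℝ] TangentSpace I x) (α β : Π x : M, Cotangent I x) (x : M) : ℝ :=
  mvfderiv I (fun y ↦ β y (P y (α y))) x (Z x) - β x (P x (lieOneForm I Z α x))
    - lieOneForm I Z β x (P x (α x))

/-- The Lie derivative of a bundle map `TM → TM`: `(L_Z F) X = [Z, F X] - F [Z, X]`. -/
def lieEndomorphism (Z : Π x : M, TangentSpace I x)
    (F : Π x : M, TangentSpace I x →L[ℝ] TangentSpace I x) (X : Π x : M, TangentSpace I x) (x : M) :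
    TangentSpace I x :=
  mlieBracket I Z (fun y ↦ F y (X y)) x - F x (mlieBracket I Z X x)

/-- The Lie derivative of a bundle map `TM → T*M`: `(L_Z σ♭) X = L_Z (σ♭ X) - σ♭ [Z, X]`. -/
def lieFlat (Z : Π x : M, TangentSpace I x)
    (σ : Π x : M, TangentSpace I x →L[ℝ] Cotangent I x) (X : Π x : M, TangentSpace I x) (x : M) :
    Cotangent I x :=
  lieOneForm I Z (fun y ↦ σ y (X y)) x - σ x (mlieBracket I Z X x)

/-- Evaluation of covectors at `u`. -/
def evalAt {x : M} (u : TangentSpace I x) : Cotangent I x →L[ℝ] ℝ where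
  toFun α := α u
  map_add' _ _ := rfl
  map_smul' _ _ := rfl
  cont := continuous_eval_const u

/-- The map `(u ∧ v)♯ α = α(u) v - α(v) u` of the bivector `u ∧ v`. -/
def wedgeSharp {x : M} (u v : TangentSpace I x) : Cotangent I x →L[ℝ] TangentSpace I x :=
  (evalAt I u).smulRight v - (evalAt I v).smulRight u

/-- The map `(α ∧ β)♭ u = α(u) β - β(u) α` of the 2-form `α ∧ β`. -/
def wedgeFlat {x : M} (α β : Cotangent I x) : TangentSpace I x →L[ℝ] Cotangent I x :=
  α.smulRight β - β.smulRight α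

end Calculus

/-! ### The product `M × ℝ` -/

section Product

variable {E : Type*} [NormedAddCommGroup E] [NormedSpace ℝ E]
  {H : Type*} [TopologicalSpace H] {I : ModelWithCorners ℝ E H}
  {M : Type*} [TopologicalSpace M] [ChartedSpace H M]

/-- The differential of the projection `M × ℝ → M`. -/
def projM (I : ModelWithCorners ℝ E H) (p : M × ℝ) :
    TangentSpace (I.prod 𝓘(ℝ, ℝ)) p →L[ℝ] TangentSpace I p.1 :=
  mfderiv (I.prod 𝓘(ℝ, ℝ)) I (Prod.fst : M × ℝ → M) p

/-- The differential of the inclusion `x ↦ (x, t)` of `M` in `M × ℝ`. -/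
def inclM (I : ModelWithCorners ℝ E H) (p : M × ℝ) :
    TangentSpace I p.1 →L[ℝ] TangentSpace (I.prod 𝓘(ℝ, ℝ)) p :=
  mfderiv I (I.prod 𝓘(ℝ, ℝ)) (fun x : M ↦ (x, p.2)) p.1

/-- The 1-form `dt` on `M × ℝ`. -/
def dt (I : ModelWithCorners ℝ E H) (p : M × ℝ) : Cotangent (I.prod 𝓘(ℝ, ℝ)) p :=
  mvfderiv (I.prod 𝓘(ℝ, ℝ)) (Prod.snd : M × ℝ → ℝ) p

/-- The vector field `d/dt` on `M × ℝ`. -/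
def ddt (I : ModelWithCorners ℝ E H) (p : M × ℝ) : TangentSpace (I.prod 𝓘(ℝ, ℝ)) p :=
  (mfderiv 𝓘(ℝ, ℝ) (I.prod 𝓘(ℝ, ℝ)) (fun t : ℝ ↦ (p.1, t)) p.2 :
    ℝ →L[ℝ] TangentSpace (I.prod 𝓘(ℝ, ℝ)) p) 1

@[simp] lemma projM_apply (p : M × ℝ) (v : TangentSpace (I.prod 𝓘(ℝ, ℝ)) p) :
    projM I p v = v.1 := by
  unfold projM; rw [mfderiv_fst]; rfl

@[simp] lemma inclM_apply (p : M × ℝ) (u : TangentSpace I p.1) :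
    inclM I p u = ((u, 0) : E × ℝ) := by
  unfold inclM; rw [mfderiv_prod_left]; rfl

@[simp] lemma dt_apply (p : M × ℝ) (v : TangentSpace (I.prod 𝓘(ℝ, ℝ)) p) :
    dt I p v = v.2 := by
  unfold dt mvfderiv; rw [mfderiv_snd]; rfl

lemma ddt_eq (p : M × ℝ) : ddt I p = ((0, 1) : E × ℝ) := by
  unfold ddt; rw [mfderiv_prod_right]; rfl

lemma projM_inclM (p : M × ℝ) (u : TangentSpace I p.1) : projM I p (inclM I p u) = u := by
  rw [projM_apply, inclM_apply]

lemma projM_ddt (p : M × ℝ) : projM I p (ddt I p) = 0 := by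
  rw [projM_apply, ddt_eq]; rfl

lemma dt_inclM (p : M × ℝ) (u : TangentSpace I p.1) : dt I p (inclM I p u) = 0 := by
  rw [dt_apply, inclM_apply]

lemma dt_ddt (p : M × ℝ) : dt I p (ddt I p) = 1 := by
  rw [dt_apply, ddt_eq]

lemma decomp (p : M × ℝ) (v : TangentSpace (I.prod 𝓘(ℝ, ℝ)) p) :
    v = inclM I p (projM I p v) + dt I p v • ddt I p := by
  rw [inclM_apply, dt_apply, ddt_eq, projM_apply]
  change (v : E × ℝ) = ((v : E × ℝ).1, (0:ℝ)) + (v : E × ℝ).2 • ((0 : E), (1:ℝ))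
  refine Prod.ext ?_ ?_ <;> simp

end Product

/-! ### Generalized almost para-contact structures -/

/-- A generalized almost para-contact structure `(F, P, σ, Z, ξ)`.  The bivector `P` is given by
`P♯ : T*M → TM` with `β(P♯ α) = P(α, β)`, the 2-form `σ` by `σ♭ : TM → T*M` with
`σ♭(X)(Y) = σ(X, Y)`.  Skewness of `P` and `σ` makes the block map `𝓕 = (F, P♯; σ♭, -F*)` skew for
the pairing, that is `𝓕 + 𝓕* = 0`; see `blockMap_skew`. -/
structure GenAlmostParaContact {E : Type*} [NormedAddCommGroup E] [NormedSpace ℝ E]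
    {H : Type*} [TopologicalSpace H] (I : ModelWithCorners ℝ E H)
    (M : Type*) [TopologicalSpace M] [ChartedSpace H M] [IsManifold I ∞ M] where
  F : Π x : M, TangentSpace I x →L[ℝ] TangentSpace I x
  P : Π x : M, Cotangent I x →L[ℝ] TangentSpace I x
  σ : Π x : M, TangentSpace I x →L[ℝ] Cotangent I x
  Z : Π x : M, TangentSpace I x
  ξ : Π x : M, Cotangent I x
  smooth_F : SmoothEndomorphism I F
  smooth_P : SmoothSharp I P
  smooth_σ : SmoothFlat I σ
  smooth_Z : SmoothVectorField I Z
  smooth_ξ : SmoothOneForm I ξ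
  P_skew : ∀ (x : M) (α β : Cotangent I x), β (P x α) = -α (P x β)
  σ_skew : ∀ (x : M) (u v : TangentSpace I x), σ x u v = -σ x v u
  ξ_Z : ∀ x : M, ξ x (Z x) = 1
  map_ξ : ∀ x : M, blockMap I (F x) (P x) (σ x) (0, ξ x) = 0
  map_Z : ∀ x : M, blockMap I (F x) (P x) (σ x) (Z x, 0) = 0
  sq : ∀ (x : M) (e : BigTangent I x),
    blockMap I (F x) (P x) (σ x) (blockMap I (F x) (P x) (σ x) e)
      = e - (ξ x e.1 • Z x, e.2 (Z x) • ξ x)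

namespace GenAlmostParaContact

variable {E : Type*} [NormedAddCommGroup E] [NormedSpace ℝ E]
  {H : Type*} [TopologicalSpace H] {I : ModelWithCorners ℝ E H}
  {M : Type*} [TopologicalSpace M] [ChartedSpace H M] [IsManifold I ∞ M]

/-- The `M`-adapted structure on `M × ℝ` of a generalized almost para-contact structure: the bundle
map `J = (a, π♯; θ♭, -a*)` with `a = F`, `π = P - Z ∧ d/dt`, `θ = σ + ξ ∧ dt`.  Explicitly
`J(X + α + f d/dt + g dt) = 𝓕(X + α) + g Z - f ξ - α(Z) d/dt + ξ(X) dt`. -/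
def adapted (S : GenAlmostParaContact I M) (p : M × ℝ) :
    BigTangent (I.prod 𝓘(ℝ, ℝ)) p →L[ℝ] BigTangent (I.prod 𝓘(ℝ, ℝ)) p :=
  blockMap (I.prod 𝓘(ℝ, ℝ))
    ((inclM I p).comp ((S.F p.1).comp (projM I p)))
    ((inclM I p).comp ((S.P p.1).comp (ContinuousLinearMap.precomp ℝ (inclM I p)))
      - wedgeSharp (I.prod 𝓘(ℝ, ℝ)) (inclM I p (S.Z p.1)) (ddt I p))
    ((ContinuousLinearMap.precomp ℝ (projM I p)).comp ((S.σ p.1).comp (projM I p))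
      + wedgeFlat (I.prod 𝓘(ℝ, ℝ)) ((S.ξ p.1).comp (projM I p)) (dt I p))

lemma adapted_apply (S : GenAlmostParaContact I M) (p : M × ℝ)
    (e : BigTangent (I.prod 𝓘(ℝ, ℝ)) p) :
    S.adapted p e =
      (inclM I p (S.F p.1 (projM I p e.1) + S.P p.1 (e.2.comp (inclM I p))
          + e.2 (ddt I p) • S.Z p.1) - e.2 (inclM I p (S.Z p.1)) • ddt I p,
        (S.σ p.1 (projM I p e.1) - (e.2.comp (inclM I p)).comp (S.F p.1)
          - dt I p e.1 • S.ξ p.1).comp (projM I p) + S.ξ p.1 (projM I p e.1) • dt I p) := by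
  unfold adapted
  rw [blockMap_apply]
  refine Prod.ext ?_ ?_
  · change inclM I p (S.F p.1 (projM I p e.1)) + (inclM I p (S.P p.1 (e.2.comp (inclM I p)))
      - (e.2 (inclM I p (S.Z p.1)) • ddt I p - e.2 (ddt I p) • inclM I p (S.Z p.1))) = _
    simp only [map_add, map_smul]
    abel
  · ext w
    change S.σ p.1 (projM I p e.1) (projM I p w)
      + (S.ξ p.1 (projM I p e.1) * dt I p w - dt I p e.1 * S.ξ p.1 (projM I p w))
      - e.2 (inclM I p (S.F p.1 (projM I p w)))
      = S.σ p.1 (projM I p e.1) (projM I p w) - e.2 (inclM I p (S.F p.1 (projM I p w)))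
        - dt I p e.1 * S.ξ p.1 (projM I p w) + S.ξ p.1 (projM I p e.1) * dt I p w
    ring

/-- The adapted structure satisfies `J² = 1`. -/
lemma adapted_adapted (S : GenAlmostParaContact I M) (p : M × ℝ)
    (e : BigTangent (I.prod 𝓘(ℝ, ℝ)) p) : S.adapted p (S.adapted p e) = e := by
  obtain ⟨v, γ⟩ := e
  set X := projM I p v with hX
  set α : Cotangent I p.1 := γ.comp (inclM I p) with hα
  have h1 := S.map_ξ p.1
  have h2 := S.map_Z p.1
  have h3 := S.sq p.1 (X, α)
  simp only [blockMap_apply, Prod.mk_eq_zero, map_zero, zero_add, zero_sub, neg_eq_zero, add_zero,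
    sub_zero, ContinuousLinearMap.zero_comp] at h1 h2
  simp only [blockMap_apply, Prod.ext_iff, Prod.fst_sub, Prod.snd_sub] at h3
  obtain ⟨h3a, h3b⟩ := h3
  have hσξ : ∀ u, S.σ p.1 u (S.Z p.1) = 0 := fun u ↦ by
    rw [S.σ_skew, h2.2]; simp
  have hξP : ∀ β, S.ξ p.1 (S.P p.1 β) = 0 := fun β ↦ by
    rw [S.P_skew, h1.1]; simp
  have hξF : ∀ u, S.ξ p.1 (S.F p.1 u) = 0 := fun u ↦ by
    simpa using congrArg (fun q ↦ q u) h1.2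
  have hγ : ∀ u, γ (inclM I p u) = α u := fun u ↦ rfl
  have e1 : projM I p (inclM I p (S.F p.1 X + S.P p.1 α + γ (ddt I p) • S.Z p.1)
      - γ (inclM I p (S.Z p.1)) • ddt I p) = S.F p.1 X + S.P p.1 α + γ (ddt I p) • S.Z p.1 := by
    rw [map_sub, map_smul, projM_inclM, projM_ddt, smul_zero, sub_zero]
  have e2 : dt I p (inclM I p (S.F p.1 X + S.P p.1 α + γ (ddt I p) • S.Z p.1)
      - γ (inclM I p (S.Z p.1)) • ddt I p) = - α (S.Z p.1) := by
    rw [map_sub, map_smul, dt_inclM, dt_ddt, hγ]; simp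
  have e3 : ∀ (β : Cotangent I p.1) (c : ℝ),
      (β.comp (projM I p) + c • dt I p).comp (inclM I p) = β := fun β c ↦ by
    ext u
    change β (projM I p (inclM I p u)) + c * dt I p (inclM I p u) = β u
    rw [projM_inclM, dt_inclM, mul_zero, add_zero]
  have e4 : ∀ (β : Cotangent I p.1) (c : ℝ),
      (β.comp (projM I p) + c • dt I p) (ddt I p) = c := fun β c ↦ by
    change β (projM I p (ddt I p)) + c * dt I p (ddt I p) = c
    rw [projM_ddt, dt_ddt, map_zero, zero_add, mul_one]
  have e5 : ∀ (β : Cotangent I p.1) (c : ℝ) (u : TangentSpace I p.1),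
      (β.comp (projM I p) + c • dt I p) (inclM I p u) = β u := fun β c u ↦
    congrArg (fun q ↦ q u) (e3 β c)
  rw [adapted_apply, adapted_apply]
  simp only [← hX, ← hα]
  rw [e1, e2, e3, e4, e5]
  refine Prod.ext ?_ ?_
  · have : S.F p.1 (S.F p.1 X + S.P p.1 α + γ (ddt I p) • S.Z p.1)
        + S.P p.1 (S.σ p.1 X - α.comp (S.F p.1) - dt I p v • S.ξ p.1)
        + S.ξ p.1 X • S.Z p.1 = X := by
      rw [map_add _ _ (γ (ddt I p) • S.Z p.1), map_smul, h2.1, map_sub _ _ (dt I p v • S.ξ p.1),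
        map_smul, h1.1, smul_zero, smul_zero, add_zero, sub_zero, h3a]
      abel
    rw [this]
    have h6 : (S.σ p.1 X - α.comp (S.F p.1) - dt I p v • S.ξ p.1) (S.Z p.1) = - dt I p v := by
      change S.σ p.1 X (S.Z p.1) - α (S.F p.1 (S.Z p.1)) - dt I p v * S.ξ p.1 (S.Z p.1) = _
      rw [hσξ, h2.1, S.ξ_Z, map_zero]; ring
    rw [h6, neg_smul, sub_neg_eq_add]
    exact (decomp p v).symm
  · have h7 : S.ξ p.1 (S.F p.1 X + S.P p.1 α + γ (ddt I p) • S.Z p.1) = γ (ddt I p) := by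
      rw [map_add, map_add, map_smul, hξF, hξP, S.ξ_Z]; simp
    rw [h7]
    ext w
    have h8 := congrArg (fun q ↦ q (projM I p w)) h3b
    have hσZ : S.σ p.1 (γ (ddt I p) • S.Z p.1) = 0 := by rw [map_smul, h2.2, smul_zero]
    rw [map_add (S.σ p.1) (_ + _), hσZ]
    conv_rhs => rw [decomp p w]
    simp only [map_add, map_smul, hγ, smul_eq_mul, sub_apply, add_apply, smul_apply,
      ContinuousLinearMap.comp_apply, hξF, add_zero, mul_zero, sub_zero, neg_mul,
      sub_neg_eq_add] at h8 ⊢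
    linarith

/-- The adapted structure is skew for the pairing. -/
lemma adapted_skew (S : GenAlmostParaContact I M) (p : M × ℝ)
    (e₁ e₂ : BigTangent (I.prod 𝓘(ℝ, ℝ)) p) :
    pairing (I.prod 𝓘(ℝ, ℝ)) (S.adapted p e₁) e₂
      + pairing (I.prod 𝓘(ℝ, ℝ)) e₁ (S.adapted p e₂) = 0 := by
  refine blockMap_skew _ _ _ _ (fun α β ↦ ?_) (fun u v ↦ ?_) _ _
  · change β (inclM I p (S.P p.1 (α.comp (inclM I p)))
        - (α (inclM I p (S.Z p.1)) • ddt I p - α (ddt I p) • inclM I p (S.Z p.1)))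
      = -α (inclM I p (S.P p.1 (β.comp (inclM I p)))
        - (β (inclM I p (S.Z p.1)) • ddt I p - β (ddt I p) • inclM I p (S.Z p.1)))
    have h := S.P_skew p.1 (α.comp (inclM I p)) (β.comp (inclM I p))
    simp only [map_sub, map_smul, smul_eq_mul, ContinuousLinearMap.comp_apply] at h ⊢
    rw [h]
    ring
  · change S.σ p.1 (projM I p u) (projM I p v)
        + (S.ξ p.1 (projM I p u) * dt I p v - dt I p u * S.ξ p.1 (projM I p v))
      = -(S.σ p.1 (projM I p v) (projM I p u)
        + (S.ξ p.1 (projM I p v) * dt I p u - dt I p v * S.ξ p.1 (projM I p u)))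
    rw [S.σ_skew]
    ring

/-- A generalized almost para-contact structure is normal if the corresponding `M`-adapted
generalized almost para-complex structure on `M × ℝ` is Courant-integrable. -/
def IsNormal (S : GenAlmostParaContact I M) : Prop :=
  CourantIntegrable (I.prod 𝓘(ℝ, ℝ)) S.adapted

end GenAlmostParaContact

end ParaContact

end

/-!
The Courant torsion of an endomorphism `J` of `TN ⊕ T*N` that is skew with `J² = 1` becomes a 3-form
after pairing it with a third section, so at each point it depends only on the values of the three
sections and on the 1-jet of `J` in a chart.  For the adapted structure on `M × ℝ`, split every
argument along `TM ⊕ T*M ⊕ ℝ d/dt ⊕ ℝ dt`: since the structure does not depend on `t`, the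
components of this 3-form are, up to sign and symmetry, the tensors whose vanishing is expressed by
the differential conditions in (A1)–(A5).  The algebraic conditions there hold for every generalized
almost para-contact structure.
-/

noncomputable section

set_option maxSynthPendingDepth 3

namespace ParaContact

/-! ### The Courant bracket of 1-jets -/

section FlatCourant

open Filter Topology

/-- The fibre `V ⊕ V*` of the big tangent bundle of a normed space `V`. -/
abbrev BigModel (V : Type*) [NormedAddCommGroup V] [NormedSpace ℝ V] : Type _ := V × (V →L[ℝ] ℝ)

variable {V : Type*} [NormedAddCommGroup V] [NormedSpace ℝ V]

/-- Twice the natural pairing on `V ⊕ V*`. -/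
def dualPairing : BigModel V →L[ℝ] BigModel V →L[ℝ] ℝ :=
  let c : BigModel V →L[ℝ] BigModel V →L[ℝ] ℝ :=
    (ContinuousLinearMap.precomp ℝ (ContinuousLinearMap.fst ℝ V (V →L[ℝ] ℝ))).comp
      (ContinuousLinearMap.snd ℝ V (V →L[ℝ] ℝ))
  c + c.flip

@[simp] lemma dualPairing_apply (a b : BigModel V) : dualPairing a b = a.2 b.1 + b.2 a.1 := rfl

lemma dualPairing_comm (a b : BigModel V) : dualPairing a b = dualPairing b a := add_comm _ _

lemma eq_zero_of_forall_dualPairing_eq_zero {a : BigModel V} (h : ∀ b, dualPairing a b = 0) :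
    a = 0 := by
  refine Prod.ext ?_ ?_
  · refine SeparatingDual.eq_zero_of_forall_dual_eq_zero (R := ℝ) fun β ↦ ?_
    simpa using h (0, β)
  · ext v
    simpa using h (v, 0)

/-- The Courant bracket at a point of two sections of `V ⊕ V*` with values `e₁, e₂` and derivatives
`D₁, D₂`, paired with `e₃` by `dualPairing`. -/
def courantForm (e₁ e₂ : BigModel V) (D₁ D₂ : V →L[ℝ] BigModel V) (e₃ : BigModel V) : ℝ :=
  dualPairing (D₂ e₁.1) e₃ - dualPairing (D₁ e₂.1) e₃
    + (1 / 2) * (dualPairing (D₁ e₃.1) e₂ - dualPairing e₁ (D₂ e₃.1))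

/-- `(J, DJ)` is a value and a derivative at a point that a field of skew endomorphisms of
`V ⊕ V*` with square `1` can have. -/
structure IsParaComplexJet (J : BigModel V →L[ℝ] BigModel V)
    (DJ : V →L[ℝ] BigModel V →L[ℝ] BigModel V) : Prop where
  involutive : ∀ a, J (J a) = a
  skew : ∀ a b, dualPairing (J a) b = -dualPairing a (J b)
  deriv_anticomm : ∀ w a, DJ w (J a) = -J (DJ w a)
  deriv_skew : ∀ w a b, dualPairing (DJ w a) b = -dualPairing a (DJ w b)

lemma deriv_anticomm_of_involutive {G : Type*} [NormedAddCommGroup G] [NormedSpace ℝ G]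
    {J : V → G →L[ℝ] G} {y : V} {DJ : V →L[ℝ] G →L[ℝ] G} (hJ : HasFDerivAt J DJ y)
    (h : ∀ᶠ z in 𝓝 y, ∀ a, J z (J z a) = a) (w : V) (a : G) : DJ w (J y a) = -J y (DJ w a) := by
  have hleft := hJ.clm_apply (hJ.clm_apply (hasFDerivAt_const a y))
  have hright : HasFDerivAt (fun z ↦ J z (J z a)) (0 : V →L[ℝ] G) y :=
    (hasFDerivAt_const a y).congr_of_eventuallyEq (h.mono fun z hz ↦ hz a)
  have := congr($(hleft.unique hright) w)
  simp only [add_apply, ContinuousLinearMap.comp_apply, ContinuousLinearMap.flip_apply,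
    zero_apply, map_zero, zero_add] at this
  exact eq_neg_of_add_eq_zero_right this

lemma deriv_skew_of_skew {J : V → BigModel V →L[ℝ] BigModel V} {y : V}
    {DJ : V →L[ℝ] BigModel V →L[ℝ] BigModel V} (hJ : HasFDerivAt J DJ y)
    (h : ∀ᶠ z in 𝓝 y, ∀ a b, dualPairing (J z a) b = -dualPairing a (J z b)) (w : V)
    (a b : BigModel V) : dualPairing (DJ w a) b = -dualPairing a (DJ w b) := by
  have hJa (a : BigModel V) := hJ.clm_apply (hasFDerivAt_const a y)
  have hleft := (dualPairing.flip b).hasFDerivAt.comp y (hJa a)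
  have hright := ((dualPairing a).hasFDerivAt.comp y (hJa b)).neg
  have := congr($(hleft.unique
    (hright.congr_of_eventuallyEq (h.mono fun z hz ↦ hz a b))) w)
  simpa using this

lemma IsParaComplexJet.of_hasFDerivAt {J : V → BigModel V →L[ℝ] BigModel V} {y : V}
    {DJ : V →L[ℝ] BigModel V →L[ℝ] BigModel V} (hJ : HasFDerivAt J DJ y)
    (hinv : ∀ᶠ z in 𝓝 y, ∀ a, J z (J z a) = a)
    (hskew : ∀ᶠ z in 𝓝 y, ∀ a b, dualPairing (J z a) b = -dualPairing a (J z b)) :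
    IsParaComplexJet (J y) DJ where
  involutive := hinv.self_of_nhds
  skew := hskew.self_of_nhds
  deriv_anticomm := deriv_anticomm_of_involutive hJ hinv
  deriv_skew := deriv_skew_of_skew hJ hskew

/-- The Courant-Nijenhuis torsion, paired with `c`, of a skew involutive endomorphism field with
value `J` and derivative `DJ` at a point. -/
def torsionForm (J : BigModel V →L[ℝ] BigModel V) (DJ : V →L[ℝ] BigModel V →L[ℝ] BigModel V)
    (a b c : BigModel V) : ℝ :=
  let S (a b c : BigModel V) : ℝ :=
    dualPairing (DJ (J a).1 b) c + dualPairing (DJ a.1 b) (J c)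
  S a b c + S b c a + S c a b

lemma courantForm_torsion {J : BigModel V →L[ℝ] BigModel V}
    {DJ : V →L[ℝ] BigModel V →L[ℝ] BigModel V} (h : IsParaComplexJet J DJ)
    (e₁ e₂ e₃ : BigModel V) (D₁ D₂ : V →L[ℝ] BigModel V) :
    courantForm (J e₁) (J e₂) (J.comp D₁ + DJ.flip e₁) (J.comp D₂ + DJ.flip e₂) e₃
      + courantForm (J e₁) e₂ (J.comp D₁ + DJ.flip e₁) D₂ (J e₃)
      + courantForm e₁ (J e₂) D₁ (J.comp D₂ + DJ.flip e₂) (J e₃)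
      + courantForm e₁ e₂ D₁ D₂ e₃
    = torsionForm J DJ e₁ e₂ e₃ := by
  have skew₂ (w a b) : dualPairing (DJ w a) (J b) = dualPairing a (J (DJ w b)) := by
    rw [h.deriv_skew, h.deriv_anticomm, map_neg, neg_neg]
  simp only [courantForm, torsionForm, add_apply, ContinuousLinearMap.comp_apply,
    ContinuousLinearMap.flip_apply, map_add, h.skew, h.involutive]
  have h₁ := h.deriv_skew (J e₂).1 e₃ e₁
  have h₂ := h.deriv_skew (J e₃).1 e₁ e₂
  have h₃ := skew₂ e₃.1 e₁ e₂
  have h₄ := skew₂ e₂.1 e₃ e₁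
  have h₅ := dualPairing_comm e₃ (DJ (J e₂).1 e₁)
  have h₆ := (dualPairing_comm e₃ (J (DJ e₂.1 e₁))).trans (h.skew _ _)
  linarith

end FlatCourant

/-! ### The adapted endomorphism -/

section AdaptedEndo

variable {E : Type*} [NormedAddCommGroup E] [NormedSpace ℝ E]

variable (E) in
/-- The space in which the tuple `(F, P, σ, Z, ξ)` takes its values when read in a chart. -/
abbrev ContactTensors : Type _ :=
  (E →L[ℝ] E) × ((E →L[ℝ] ℝ) →L[ℝ] E) × (E →L[ℝ] E →L[ℝ] ℝ) × E × (E →L[ℝ] ℝ)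

namespace ContactTensors

variable (τ : ContactTensors E)

/-- The component `F` of `(F, P, σ, Z, ξ)`. -/
abbrev F : E →L[ℝ] E := τ.1

/-- The component `P` of `(F, P, σ, Z, ξ)`. -/
abbrev P : (E →L[ℝ] ℝ) →L[ℝ] E := τ.2.1

/-- The component `σ` of `(F, P, σ, Z, ξ)`. -/
abbrev σ : E →L[ℝ] E →L[ℝ] ℝ := τ.2.2.1

/-- The component `Z` of `(F, P, σ, Z, ξ)`. -/
abbrev Z : E := τ.2.2.2.1

/-- The component `ξ` of `(F, P, σ, Z, ξ)`. -/
abbrev ξ : E →L[ℝ] ℝ := τ.2.2.2.2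

end ContactTensors

/-- The element `u + f d/dt + α + g dt` of the big tangent space of `E × ℝ`. -/
def bigVector (u : E) (f : ℝ) (α : E →L[ℝ] ℝ) (g : ℝ) : BigModel (E × ℝ) :=
  ((u, f), α.coprod (g • ContinuousLinearMap.id ℝ ℝ))

@[simp] lemma bigVector_fst (u : E) (f : ℝ) (α : E →L[ℝ] ℝ) (g : ℝ) :
    (bigVector u f α g).1 = (u, f) := rfl

@[simp] lemma bigVector_snd_apply (u : E) (f : ℝ) (α : E →L[ℝ] ℝ) (g : ℝ) (v : E × ℝ) :
    (bigVector u f α g).2 v = α v.1 + g * v.2 := rfl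

lemma eq_bigVector (e : BigModel (E × ℝ)) :
    e = bigVector e.1.1 e.1.2 (e.2.comp (.inl ℝ E ℝ)) (e.2 (0, 1)) := by
  refine Prod.ext rfl (ContinuousLinearMap.ext fun v ↦ ?_)
  have hv : v = (v.1, 0) + v.2 • (0, 1) := by ext <;> simp
  conv_lhs => rw [hv, map_add, map_smul]
  rw [bigVector_snd_apply, mul_comm]
  rfl

/-- The adapted endomorphism `u + f d/dt + α + g dt ↦ (F u + P α + g Z) - α(Z) d/dt
+ (σ u - α ∘ F - f ξ) + ξ(u) dt`, as a function of `(F, P, σ, Z, ξ)` and of the vector. -/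
def adaptedEndoAux (τ : ContactTensors E) (e : BigModel (E × ℝ)) : BigModel (E × ℝ) :=
  let α : E →L[ℝ] ℝ := e.2.comp (.inl ℝ E ℝ)
  bigVector (τ.F e.1.1 + τ.P α + e.2 (0, 1) • τ.Z) (-α τ.Z)
    (τ.σ e.1.1 - α.comp τ.F - e.1.2 • τ.ξ) (τ.ξ e.1.1)

lemma isBilinearMap_adaptedEndoAux : IsBilinearMap ℝ (adaptedEndoAux (E := E)) := by
  constructor <;> intros <;>
  refine Prod.ext (Prod.ext ?_ ?_) (ContinuousLinearMap.ext fun v ↦ ?_) <;>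
  simp only [adaptedEndoAux, ContactTensors.F, ContactTensors.P, ContactTensors.σ,
    ContactTensors.Z, ContactTensors.ξ, bigVector_fst, bigVector_snd_apply, Prod.fst_add,
    Prod.snd_add, Prod.smul_fst, Prod.smul_snd, add_apply, sub_apply, smul_apply,
    ContinuousLinearMap.add_comp, ContinuousLinearMap.smul_comp, ContinuousLinearMap.comp_apply,
    map_add, map_smul, smul_eq_mul] <;>
  first | module | ring

variable [FiniteDimensional ℝ E]

/-- The adapted endomorphism `X + f d/dt + α + g dt ↦ 𝓕(X + α) + g Z - f ξ - α(Z) d/dt + ξ(X) dt`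
of the big tangent space of `E × ℝ`; it depends linearly on `(F, P, σ, Z, ξ)`. -/
def adaptedEndo : ContactTensors E →L[ℝ] BigModel (E × ℝ) →L[ℝ] BigModel (E × ℝ) :=
  isBilinearMap_adaptedEndoAux.toContinuousBilinearMap

@[simp] lemma adaptedEndo_bigVector (τ : ContactTensors E) (u : E) (f : ℝ) (α : E →L[ℝ] ℝ) (g : ℝ) :
    adaptedEndo τ (bigVector u f α g) =
      bigVector (τ.F u + τ.P α + g • τ.Z) (-α τ.Z) (τ.σ u - α.comp τ.F - f • τ.ξ) (τ.ξ u) := by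
  have hα : (bigVector u f α g).2.comp (.inl ℝ E ℝ) = α := by ext; simp
  have hg : (bigVector u f α g).2 (0, 1) = g := by simp
  change adaptedEndoAux τ _ = _
  simp only [adaptedEndoAux, hα, hg, bigVector_fst]

end AdaptedEndo

/-! ### Para-contact jets and the components of their torsion -/

variable {E : Type*} [NormedAddCommGroup E] [NormedSpace ℝ E]

variable (E) in
/-- The 1-jet at a point of a field of tuples `(F, P, σ, Z, ξ)` on `E`. -/
structure ContactJet where
  val : ContactTensors E
  deriv : E →L[ℝ] ContactTensors E

namespace ContactJet

variable (j : ContactJet E)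

/-- The value of `F`. -/
abbrev F : E →L[ℝ] E := j.val.F

/-- The value of `P`. -/
abbrev P : (E →L[ℝ] ℝ) →L[ℝ] E := j.val.P

/-- The value of `σ`. -/
abbrev σ : E →L[ℝ] E →L[ℝ] ℝ := j.val.σ

/-- The value of `Z`. -/
abbrev Z : E := j.val.Z

/-- The value of `ξ`. -/
abbrev ξ : E →L[ℝ] ℝ := j.val.ξ

/-- The derivative of `F`, with the direction as first argument. -/
def DF : E →L[ℝ] E →L[ℝ] E := .fst ℝ _ _ ∘L j.deriv

/-- The derivative of `P`, with the direction as first argument. -/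
def DP : E →L[ℝ] (E →L[ℝ] ℝ) →L[ℝ] E := .fst ℝ _ _ ∘L .snd ℝ _ _ ∘L j.deriv

/-- The derivative of `σ`, with the direction as first argument. -/
def Dσ : E →L[ℝ] E →L[ℝ] E →L[ℝ] ℝ := .fst ℝ _ _ ∘L .snd ℝ _ _ ∘L .snd ℝ _ _ ∘L j.deriv

/-- The derivative of `Z`. -/
def DZ : E →L[ℝ] E := .fst ℝ _ _ ∘L .snd ℝ _ _ ∘L .snd ℝ _ _ ∘L .snd ℝ _ _ ∘L j.deriv

/-- The derivative of `ξ`, with the direction as first argument. -/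
def Dξ : E →L[ℝ] E →L[ℝ] ℝ := .snd ℝ _ _ ∘L .snd ℝ _ _ ∘L .snd ℝ _ _ ∘L .snd ℝ _ _ ∘L j.deriv

@[simp]
lemma deriv_F (w : E) : (j.deriv w).F = j.DF w := rfl

@[simp]
lemma deriv_P (w : E) : (j.deriv w).P = j.DP w := rfl

@[simp]
lemma deriv_σ (w : E) : (j.deriv w).σ = j.Dσ w := rfl

@[simp]
lemma deriv_Z (w : E) : (j.deriv w).Z = j.DZ w := rfl

@[simp]
lemma deriv_ξ (w : E) : (j.deriv w).ξ = j.Dξ w := rfl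

/-- The exterior derivative of `σ`. -/
def dσ (u v w : E) : ℝ := j.Dσ u v w + j.Dσ v w u + j.Dσ w u v

/-- The exterior derivative of `σ_F = σ(F·, ·)`. -/
def dσF (u v w : E) : ℝ :=
  (j.Dσ u (j.F v) w + j.σ (j.DF u v) w) + (j.Dσ v (j.F w) u + j.σ (j.DF v w) u)
    + (j.Dσ w (j.F u) v + j.σ (j.DF w u) v)

/-- Condition (A1): the Schouten bracket of `P` with itself. -/
def schouten (α β γ : E →L[ℝ] ℝ) : ℝ :=
  γ (j.DP (j.P α) β) - γ (j.DP (j.P β) α) + β (j.DP (j.P γ) α)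

/-- Condition (A2): the concomitant of `P` and `F`. -/
def concomitant (α β : E →L[ℝ] ℝ) (u : E) : ℝ :=
  β (j.DP (j.F u) α) - β (j.DF (j.P α) u) - β (j.F (j.DP u α)) + α (j.DF (j.P β) u)
    - α (j.DF u (j.P β))

/-- Condition (A3): the tensor `N_F - P(dσ) - dξ ⊗ Z`. -/
def nijenhuisDefect (u v : E) (γ : E →L[ℝ] ℝ) : ℝ :=
  γ (j.DF (j.F u) v) - γ (j.DF (j.F v) u) + γ (j.F (j.DF v u)) - γ (j.F (j.DF u v))
    + j.dσ u v (j.P γ) - (j.Dξ u v - j.Dξ v u) * γ j.Z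

/-- Condition (A4) on `ξ`: the tensor `(u, v) ↦ (L_{Fu} ξ)(v) - (L_{Fv} ξ)(u)`. -/
def lieFξ (u v : E) : ℝ :=
  j.Dξ (j.F u) v + j.ξ (j.DF v u) - (j.Dξ (j.F v) u + j.ξ (j.DF u v))

/-- Condition (A4) on `σ`: the defect of `dσ_F = i_F dσ`. -/
def exteriorDefect (u v w : E) : ℝ :=
  j.dσ (j.F u) v w + j.dσ u (j.F v) w + j.dσ u v (j.F w) - j.dσF u v w

/-- Condition (A5): the Lie derivative `L_Z ξ`. -/
def lieZξ (u : E) : ℝ := j.Dξ j.Z u + j.ξ (j.DZ u)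

/-- Condition (A5): the Lie derivative `L_Z P`. -/
def lieZP (α β : E →L[ℝ] ℝ) : ℝ := β (j.DP j.Z α) + α (j.DZ (j.P β)) - β (j.DZ (j.P α))

/-- Condition (A5): the Lie derivative `L_Z F`. -/
def lieZF (u : E) (γ : E →L[ℝ] ℝ) : ℝ := γ (j.DF j.Z u) - γ (j.DZ (j.F u)) + γ (j.F (j.DZ u))

/-- Condition (A5): the Lie derivative `L_Z σ`. -/
def lieZσ (u v : E) : ℝ := j.Dσ j.Z u v + j.σ u (j.DZ v) + j.σ (j.DZ u) v

/-- Condition (A5): the Lie derivatives of `ξ` along the fields `P α`. -/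
def liePξ (α : E →L[ℝ] ℝ) (u : E) : ℝ := j.Dξ (j.P α) u + j.ξ (j.DP u α)

variable [FiniteDimensional ℝ E]

/-- The derivative of the adapted endomorphism on `E × ℝ`; it does not depend on `t`. -/
def derivEndo : E × ℝ →L[ℝ] BigModel (E × ℝ) →L[ℝ] BigModel (E × ℝ) :=
  (adaptedEndo.comp j.deriv).comp (.fst ℝ E ℝ)

lemma derivEndo_apply (w : E × ℝ) : j.derivEndo w = adaptedEndo (j.deriv w.1) := rfl

/-- The jet of a field of tuples whose adapted endomorphisms are skew with square `1`. -/
def IsParaContact : Prop := IsParaComplexJet (adaptedEndo j.val) j.derivEndo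

/-- The Courant-Nijenhuis torsion of the adapted endomorphism. -/
def torsion (a b c : BigModel (E × ℝ)) : ℝ := torsionForm (adaptedEndo j.val) j.derivEndo a b c

variable {j}

namespace IsParaContact

variable (h : j.IsParaContact)
include h

lemma P_skew (α β : E →L[ℝ] ℝ) : β (j.P α) = -α (j.P β) := by
  simpa using h.skew (bigVector 0 0 α 0) (bigVector 0 0 β 0)

lemma σ_skew (u v : E) : j.σ u v = -j.σ v u := by
  simpa using h.skew (bigVector u 0 0 0) (bigVector v 0 0 0)

lemma DP_skew (w : E) (α β : E →L[ℝ] ℝ) : β (j.DP w α) = -α (j.DP w β) := by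
  simpa [derivEndo_apply] using h.deriv_skew (w, 0) (bigVector 0 0 α 0) (bigVector 0 0 β 0)

lemma Dσ_skew (w u v : E) : j.Dσ w u v = -j.Dσ w v u := by
  simpa [derivEndo_apply] using h.deriv_skew (w, 0) (bigVector u 0 0 0) (bigVector v 0 0 0)

lemma dualPairing_derivEndo (w : E) (a b : BigModel (E × ℝ)) :
    dualPairing (adaptedEndo (j.deriv w) a) (adaptedEndo j.val b)
      = -dualPairing (adaptedEndo (j.deriv w) b) (adaptedEndo j.val a) := by
  calc dualPairing (adaptedEndo (j.deriv w) a) (adaptedEndo j.val b)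
      = -dualPairing (adaptedEndo j.val (adaptedEndo (j.deriv w) a)) b := by rw [h.skew, neg_neg]
    _ = dualPairing (adaptedEndo (j.deriv w) (adaptedEndo j.val a)) b := by
      rw [← neg_apply, ← map_neg]
      exact congr(dualPairing $(h.deriv_anticomm (w, 0) a) b).symm
    _ = -dualPairing (adaptedEndo j.val a) (adaptedEndo (j.deriv w) b) :=
      h.deriv_skew (w, 0) (adaptedEndo j.val a) b
    _ = -dualPairing (adaptedEndo (j.deriv w) b) (adaptedEndo j.val a) := by rw [dualPairing_comm]

lemma deriv_mixed (w u : E) (α : E →L[ℝ] ℝ) :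
    -α (j.DF w (j.F u)) + (j.σ u (j.DP w α) - j.ξ u * α (j.DZ w))
      = α (j.F (j.DF w u)) - (j.Dσ w u (j.P α) - j.Dξ w u * α j.Z) := by
  simpa [← sub_eq_add_neg] using
    h.dualPairing_derivEndo w (bigVector 0 0 α 0) (bigVector u 0 0 0)

lemma ξ_DF (w u : E) : j.ξ (j.DF w u) = -j.Dξ w (j.F u) := by
  simpa [neg_eq_iff_eq_neg] using
    h.dualPairing_derivEndo w (bigVector u 0 0 0) (bigVector 0 1 0 0)

lemma ξ_DP (w : E) (α : E →L[ℝ] ℝ) : j.ξ (j.DP w α) = -j.Dξ w (j.P α) := by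
  simpa [neg_eq_iff_eq_neg] using
    h.dualPairing_derivEndo w (bigVector 0 0 α 0) (bigVector 0 1 0 0)

lemma ξ_DZ (w : E) : j.ξ (j.DZ w) = -j.Dξ w j.Z := by
  simpa [neg_eq_iff_eq_neg] using
    h.dualPairing_derivEndo w (bigVector 0 0 0 1) (bigVector 0 1 0 0)

lemma Dσ_Z (w u : E) : j.Dσ w u j.Z = -j.σ u (j.DZ w) := by
  simpa using h.dualPairing_derivEndo w (bigVector u 0 0 0) (bigVector 0 0 0 1)

lemma DF_Z (w : E) (α : E →L[ℝ] ℝ) : α (j.DF w j.Z) = -α (j.F (j.DZ w)) := by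
  simpa [neg_eq_iff_eq_neg] using
    h.dualPairing_derivEndo w (bigVector 0 0 α 0) (bigVector 0 0 0 1)

lemma torsion_bigVector (u₁ u₂ u₃ : E) (f₁ f₂ f₃ : ℝ) (α₁ α₂ α₃ : E →L[ℝ] ℝ) (g₁ g₂ g₃ : ℝ) :
    j.torsion (bigVector u₁ f₁ α₁ g₁) (bigVector u₂ f₂ α₂ g₂) (bigVector u₃ f₃ α₃ g₃)
      = j.schouten α₁ α₂ α₃
        + (j.concomitant α₁ α₂ u₃ + j.concomitant α₂ α₃ u₁ + j.concomitant α₃ α₁ u₂)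
        + (j.nijenhuisDefect u₁ u₂ α₃ + j.nijenhuisDefect u₂ u₃ α₁ + j.nijenhuisDefect u₃ u₁ α₂)
        + j.exteriorDefect u₁ u₂ u₃
        + (f₁ * (j.lieFξ u₂ u₃ + j.liePξ α₂ u₃ - j.liePξ α₃ u₂)
          + f₂ * (j.lieFξ u₃ u₁ + j.liePξ α₃ u₁ - j.liePξ α₁ u₃)
          + f₃ * (j.lieFξ u₁ u₂ + j.liePξ α₁ u₂ - j.liePξ α₂ u₁))
        + (g₁ * (j.lieZσ u₂ u₃ + j.lieZF u₂ α₃ - j.lieZF u₃ α₂ + j.lieZP α₂ α₃)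
          + g₂ * (j.lieZσ u₃ u₁ + j.lieZF u₃ α₁ - j.lieZF u₁ α₃ + j.lieZP α₃ α₁)
          + g₃ * (j.lieZσ u₁ u₂ + j.lieZF u₁ α₂ - j.lieZF u₂ α₁ + j.lieZP α₁ α₂))
        + ((f₁ * g₂ - g₁ * f₂) * j.lieZξ u₃ + (f₂ * g₃ - g₂ * f₃) * j.lieZξ u₁
          + (f₃ * g₁ - g₃ * f₁) * j.lieZξ u₂) := by
  simp only [torsion, torsionForm, derivEndo_apply, adaptedEndo_bigVector, dualPairing_apply,
    bigVector_fst, bigVector_snd_apply, deriv_F, deriv_P, deriv_σ, deriv_Z, deriv_ξ, schouten,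
    concomitant, nijenhuisDefect, exteriorDefect, dσ, dσF, lieFξ, lieZξ, lieZP, lieZF, lieZσ,
    liePξ, map_add, map_smul, add_apply, sub_apply, smul_apply, ContinuousLinearMap.comp_apply,
    smul_eq_mul]
  linear_combination (norm := grind) h.DP_skew (j.P α₂) α₃ α₁
    + h.deriv_mixed u₂ u₁ α₃ + h.deriv_mixed u₃ u₂ α₁ + h.deriv_mixed u₁ u₃ α₂
    - h.Dσ_skew u₂ u₁ (j.P α₃) - h.Dσ_skew u₃ u₂ (j.P α₁) - h.Dσ_skew u₁ u₃ (j.P α₂)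
    + h.σ_skew u₃ (j.DF u₁ u₂) + h.σ_skew u₁ (j.DF u₂ u₃) + h.σ_skew u₂ (j.DF u₃ u₁)
    - f₁ * (h.ξ_DF u₃ u₂ + h.ξ_DP u₃ α₂ + g₂ * h.ξ_DZ u₃)
    - f₂ * (h.ξ_DF u₁ u₃ + h.ξ_DP u₁ α₃ + g₃ * h.ξ_DZ u₁)
    - f₃ * (h.ξ_DF u₂ u₁ + h.ξ_DP u₂ α₁ + g₁ * h.ξ_DZ u₂)
    + g₁ * (h.Dσ_Z u₂ u₃ - h.σ_skew u₃ (j.DZ u₂) - h.DF_Z u₂ α₃)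
    + g₂ * (h.Dσ_Z u₃ u₁ - h.σ_skew u₁ (j.DZ u₃) - h.DF_Z u₃ α₁)
    + g₃ * (h.Dσ_Z u₁ u₂ - h.σ_skew u₂ (j.DZ u₁) - h.DF_Z u₁ α₂)

theorem forall_torsion_eq_zero_iff :
    (∀ a b c, j.torsion a b c = 0) ↔
      (∀ α β γ, j.schouten α β γ = 0) ∧ (∀ α β u, j.concomitant α β u = 0) ∧
      (∀ u v γ, j.nijenhuisDefect u v γ = 0) ∧ (∀ u v, j.lieFξ u v = 0) ∧
      (∀ u v w, j.exteriorDefect u v w = 0) ∧ (∀ u, j.lieZξ u = 0) ∧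
      (∀ α β, j.lieZP α β = 0) ∧ (∀ u γ, j.lieZF u γ = 0) ∧ (∀ u v, j.lieZσ u v = 0) ∧
      (∀ α u, j.liePξ α u = 0) := by
  constructor
  · intro ht
    have ht' (u₁ u₂ u₃ f₁ f₂ f₃ α₁ α₂ α₃ g₁ g₂ g₃) :=
      (h.torsion_bigVector u₁ u₂ u₃ f₁ f₂ f₃ α₁ α₂ α₃ g₁ g₂ g₃).symm.trans (ht _ _ _)
    simp only [schouten, concomitant, nijenhuisDefect, lieFξ, exteriorDefect, lieZξ, lieZP, lieZF,
      lieZσ, liePξ, dσ, dσF] at ht' ⊢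
    exact
      ⟨fun α β γ ↦ by simpa using ht' 0 0 0 0 0 0 α β γ 0 0 0,
        fun α β u ↦ by simpa using ht' 0 0 u 0 0 0 α β 0 0 0 0,
        fun u v γ ↦ by simpa using ht' u v 0 0 0 0 0 0 γ 0 0 0,
        fun u v ↦ by simpa using ht' 0 u v 1 0 0 0 0 0 0 0 0,
        fun u v w ↦ by simpa using ht' u v w 0 0 0 0 0 0 0 0 0,
        fun u ↦ by simpa using ht' 0 0 u 1 0 0 0 0 0 0 1 0,
        fun α β ↦ by simpa using ht' 0 0 0 0 0 0 0 α β 1 0 0,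
        fun u γ ↦ by simpa using ht' 0 u 0 0 0 0 0 0 γ 1 0 0,
        fun u v ↦ by simpa using ht' 0 u v 0 0 0 0 0 0 1 0 0,
        fun α u ↦ by simpa using ht' 0 0 u 1 0 0 0 α 0 0 0 0⟩
  · rintro ⟨hα, hαu, huα, hfu, hu, hfg, hgα, hguα, hgu, hfα⟩ a b c
    rw [eq_bigVector a, eq_bigVector b, eq_bigVector c, h.torsion_bigVector]
    simp only [hα, hαu, huα, hfu, hu, hfg, hgα, hguα, hgu, hfα, add_zero, sub_zero, mul_zero]

end IsParaContact

end ContactJet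

/-! ### Tensor calculus in the preferred chart at a point -/

section Jets

variable {E : Type*} [NormedAddCommGroup E] [NormedSpace ℝ E]
  {G G' G'' : Type*} [NormedAddCommGroup G] [NormedSpace ℝ G]
  [NormedAddCommGroup G'] [NormedSpace ℝ G'] [NormedAddCommGroup G''] [NormedSpace ℝ G'']

/-- `f` has the 1-jet `(a, D)` at `y`.  Recording the value separately lets it be given as an
element of the model space rather than of a tangent space. -/
structure HasJetAt (f : E → G) (a : G) (D : E →L[ℝ] G) (y : E) : Prop where
  value_eq : f y = a
  hasFDerivAt : HasFDerivAt f D y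

namespace HasJetAt

variable {y : E}

lemma congr {f g : E → G} {a : G} {D : E →L[ℝ] G} (hf : HasJetAt f a D y)
    (h : g =ᶠ[nhds y] f) : HasJetAt g a D y :=
  ⟨h.eq_of_nhds.trans hf.value_eq, hf.hasFDerivAt.congr_of_eventuallyEq h⟩

lemma clm_apply {c : E → G →L[ℝ] G'} {c₀ : G →L[ℝ] G'} {Dc : E →L[ℝ] G →L[ℝ] G'} {u : E → G}
    {u₀ : G} {Du : E →L[ℝ] G} (hc : HasJetAt c c₀ Dc y) (hu : HasJetAt u u₀ Du y) :
    HasJetAt (fun z ↦ c z (u z)) (c₀ u₀) (c₀.comp Du + Dc.flip u₀) y := by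
  obtain ⟨rfl, hc⟩ := hc
  obtain ⟨rfl, hu⟩ := hu
  exact ⟨rfl, hc.clm_apply hu⟩

lemma clm_comp {c : E → G' →L[ℝ] G''} {c₀ : G' →L[ℝ] G''} {Dc : E →L[ℝ] G' →L[ℝ] G''}
    {b : E → G →L[ℝ] G'} {b₀ : G →L[ℝ] G'} {Db : E →L[ℝ] G →L[ℝ] G'}
    (hc : HasJetAt c c₀ Dc y) (hb : HasJetAt b b₀ Db y) :
    HasJetAt (fun z ↦ (c z).comp (b z)) (c₀.comp b₀)
      ((ContinuousLinearMap.compL ℝ G G' G'' c₀).comp Db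
        + ((ContinuousLinearMap.compL ℝ G G' G'').flip b₀).comp Dc) y := by
  obtain ⟨rfl, hc⟩ := hc
  obtain ⟨rfl, hb⟩ := hb
  exact ⟨rfl, hc.clm_comp hb⟩

lemma fst {f : E → G × G'} {a : G × G'} {D : E →L[ℝ] G × G'} (hf : HasJetAt f a D y) :
    HasJetAt (fun z ↦ (f z).1) a.1 ((ContinuousLinearMap.fst ℝ G G').comp D) y :=
  ⟨congr(($hf.value_eq).1), hf.hasFDerivAt.fst⟩

lemma snd {f : E → G × G'} {a : G × G'} {D : E →L[ℝ] G × G'} (hf : HasJetAt f a D y) :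
    HasJetAt (fun z ↦ (f z).2) a.2 ((ContinuousLinearMap.snd ℝ G G').comp D) y :=
  ⟨congr(($hf.value_eq).2), hf.hasFDerivAt.snd⟩

end HasJetAt

end Jets

section ChartReading

variable {E : Type*} [NormedAddCommGroup E] [NormedSpace ℝ E]
  {H : Type*} [TopologicalSpace H] (I : ModelWithCorners ℝ E H)
  {M : Type*} [TopologicalSpace M] [ChartedSpace H M]

/-- The differential at `z` of the preferred chart at `x₀`. -/
def chartDerivAt (x₀ z : M) : TangentSpace I z →L[ℝ] E :=
  mfderiv I 𝓘(ℝ, E) (extChartAt I x₀) z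

/-- The vector field `X` read in the preferred chart at `x₀`. -/
def chartVectorField (X : Π x : M, TangentSpace I x) (x₀ : M) (y : E) : E :=
  chartDerivAt I x₀ ((extChartAt I x₀).symm y) (X ((extChartAt I x₀).symm y))

/-- The endomorphism `F` read in the preferred chart at `x₀`. -/
def chartEndomorphism (F : Π x : M, TangentSpace I x →L[ℝ] TangentSpace I x) (x₀ : M) (y : E) :
    E →L[ℝ] E :=
  (chartDerivAt I x₀ ((extChartAt I x₀).symm y)).comp
    ((F ((extChartAt I x₀).symm y)).comp (chartSymmDeriv I x₀ y))

/-- The bundle map `P : T*M → TM` read in the preferred chart at `x₀`. -/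
def chartSharp (P : Π x : M, Cotangent I x →L[ℝ] TangentSpace I x) (x₀ : M) (y : E) :
    (E →L[ℝ] ℝ) →L[ℝ] E :=
  (chartDerivAt I x₀ ((extChartAt I x₀).symm y)).comp
    ((P ((extChartAt I x₀).symm y)).comp
      (ContinuousLinearMap.precomp ℝ (chartDerivAt I x₀ ((extChartAt I x₀).symm y))))

variable [IsManifold I ∞ M]

lemma chartDerivAt_chartSymmDeriv {x₀ : M} {y : E} (hy : y ∈ (extChartAt I x₀).target) (v : E) :
    chartDerivAt I x₀ ((extChartAt I x₀).symm y) (chartSymmDeriv I x₀ y v) = v := by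
  have : IsManifold I 1 M := .of_le (n := ∞) (by simp)
  exact congr($(mfderiv_extChartAt_comp_mfderivWithin_extChartAt_symm (I := I) hy) v)

lemma chartSymmDeriv_chartDerivAt {x₀ : M} {y : E} (hy : y ∈ (extChartAt I x₀).target)
    (v : TangentSpace I ((extChartAt I x₀).symm y)) :
    chartSymmDeriv I x₀ y (chartDerivAt I x₀ ((extChartAt I x₀).symm y) v) = v := by
  have : IsManifold I 1 M := .of_le (n := ∞) (by simp)
  exact congr($(mfderivWithin_extChartAt_symm_comp_mfderiv_extChartAt (I := I) hy) v)

lemma chartDeriv_eq (x : M) (v : E) : chartDeriv I x v = v := by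
  have : IsManifold I 1 M := .of_le (n := ∞) (by simp)
  exact congr($(mfderiv_extChartAt_self (I := I) (x := x)) v)

lemma chartSymmDeriv_self (x : M) (v : E) :
    chartSymmDeriv I x (extChartAt I x x) v = (v : E) := by
  have : IsManifold I 1 M := .of_le (n := ∞) (by simp)
  exact congr($(mfderivWithin_range_extChartAt_symm (I := I) (x := x)) v)

lemma chartVectorField_self (X : Π x : M, TangentSpace I x) (x : M) :
    chartVectorField I X x (extChartAt I x x) = X x :=
  (congrArg (fun z ↦ (chartDerivAt I x z (X z) : E)) (extChartAt_to_inv x)).trans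
    (chartDeriv_eq I x _)

lemma chartOneForm_self (α : Π x : M, Cotangent I x) (x : M) :
    chartOneForm I α x (extChartAt I x x) = α x := by
  ext v
  exact (congrArg (α _) (chartSymmDeriv_self I x v)).trans
    (congrArg (fun z ↦ (α z : E →L[ℝ] ℝ) v) (extChartAt_to_inv x))

lemma chartEndomorphism_self (F : Π x : M, TangentSpace I x →L[ℝ] TangentSpace I x) (x : M) :
    chartEndomorphism I F x (extChartAt I x x) = F x := by
  ext v
  exact (congrArg (fun w ↦ chartDerivAt I x _ (F _ w)) (chartSymmDeriv_self I x v)).trans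
    (chartVectorField_self I (fun z ↦ F z (v : E)) x)

lemma chartSharp_self (P : Π x : M, Cotangent I x →L[ℝ] TangentSpace I x) (x : M) :
    chartSharp I P x (extChartAt I x x) = P x := by
  ext α
  have hα : α.comp (chartDerivAt I x x) = α := by
    ext v
    exact congrArg α (chartDeriv_eq I x v)
  exact (chartVectorField_self I (fun z ↦ P z (α.comp (chartDerivAt I x z))) x).trans
    (congrArg (P x) hα)

lemma chartTwoForm_self (σ : Π x : M, TangentSpace I x →L[ℝ] Cotangent I x) (x : M) :
    chartTwoForm I σ x (extChartAt I x x) = σ x := by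
  ext u v
  exact (congrArg (fun w ↦ σ _ w _) (chartSymmDeriv_self I x u)).trans
    congr($(chartOneForm_self I (fun z ↦ σ z (u : E)) x) v)

variable {I} {x₀ : M} {y : E}

lemma chartVectorField_endomorphism (hy : y ∈ (extChartAt I x₀).target)
    (F : Π x : M, TangentSpace I x →L[ℝ] TangentSpace I x) (X : Π x : M, TangentSpace I x) :
    chartVectorField I (fun z ↦ F z (X z)) x₀ y
      = chartEndomorphism I F x₀ y (chartVectorField I X x₀ y) :=
  congrArg (fun w ↦ chartDerivAt I x₀ _ (F _ w)) (chartSymmDeriv_chartDerivAt I hy (X _)).symm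

lemma comp_chartSymmDeriv_comp_chartDerivAt (hy : y ∈ (extChartAt I x₀).target)
    (α : Cotangent I ((extChartAt I x₀).symm y)) :
    (α.comp (chartSymmDeriv I x₀ y)).comp (chartDerivAt I x₀ ((extChartAt I x₀).symm y)) = α := by
  ext v
  exact congrArg α (chartSymmDeriv_chartDerivAt I hy v)

lemma chartVectorField_sharp (hy : y ∈ (extChartAt I x₀).target)
    (P : Π x : M, Cotangent I x →L[ℝ] TangentSpace I x) (α : Π x : M, Cotangent I x) :
    chartVectorField I (fun z ↦ P z (α z)) x₀ y
      = chartSharp I P x₀ y (chartOneForm I α x₀ y) :=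
  congrArg (fun w ↦ chartDerivAt I x₀ _ (P _ w))
    (comp_chartSymmDeriv_comp_chartDerivAt hy (α _)).symm

lemma chartOneForm_flat (hy : y ∈ (extChartAt I x₀).target)
    (σ : Π x : M, TangentSpace I x →L[ℝ] Cotangent I x) (X : Π x : M, TangentSpace I x) :
    chartOneForm I (fun z ↦ σ z (X z)) x₀ y
      = chartTwoForm I σ x₀ y (chartVectorField I X x₀ y) := by
  ext v
  exact congrArg (fun w ↦ σ _ w _) (chartSymmDeriv_chartDerivAt I hy (X _)).symm

lemma chartOneForm_comp (hy : y ∈ (extChartAt I x₀).target) (α : Π x : M, Cotangent I x)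
    (F : Π x : M, TangentSpace I x →L[ℝ] TangentSpace I x) :
    chartOneForm I (fun z ↦ (α z).comp (F z)) x₀ y
      = (chartOneForm I α x₀ y).comp (chartEndomorphism I F x₀ y) := by
  ext v
  exact congrArg (α _) (chartSymmDeriv_chartDerivAt I hy (F _ _)).symm

lemma chartTwoForm_comp (hy : y ∈ (extChartAt I x₀).target)
    (σ : Π x : M, TangentSpace I x →L[ℝ] Cotangent I x)
    (F : Π x : M, TangentSpace I x →L[ℝ] TangentSpace I x) :
    chartTwoForm I (fun z ↦ (σ z).comp (F z)) x₀ y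
      = (chartTwoForm I σ x₀ y).comp (chartEndomorphism I F x₀ y) := by
  ext u v
  exact congrArg (fun w ↦ σ _ w _) (chartSymmDeriv_chartDerivAt I hy (F _ _)).symm

lemma chartOneForm_apply_chartVectorField (hy : y ∈ (extChartAt I x₀).target)
    (α : Π x : M, Cotangent I x) (X : Π x : M, TangentSpace I x) :
    chartOneForm I α x₀ y (chartVectorField I X x₀ y)
      = α ((extChartAt I x₀).symm y) (X ((extChartAt I x₀).symm y)) :=
  congrArg (α _) (chartSymmDeriv_chartDerivAt I hy (X _))

end ChartReading

section ChartJets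

open Filter Topology

variable {E : Type*} [NormedAddCommGroup E] [NormedSpace ℝ E]
  {H : Type*} [TopologicalSpace H] {I : ModelWithCorners ℝ E H} [I.Boundaryless]
  {M : Type*} [TopologicalSpace M] [ChartedSpace H M] [IsManifold I ∞ M] {x : M}
  {F : Π x : M, TangentSpace I x →L[ℝ] TangentSpace I x}
  {P : Π x : M, Cotangent I x →L[ℝ] TangentSpace I x}
  {σ : Π x : M, TangentSpace I x →L[ℝ] Cotangent I x} {X Y : Π x : M, TangentSpace I x}
  {α : Π x : M, Cotangent I x} {F₀ : E →L[ℝ] E} {DF : E →L[ℝ] E →L[ℝ] E}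
  {P₀ : (E →L[ℝ] ℝ) →L[ℝ] E} {DP : E →L[ℝ] (E →L[ℝ] ℝ) →L[ℝ] E} {σ₀ : E →L[ℝ] E →L[ℝ] ℝ}
  {Dσ : E →L[ℝ] E →L[ℝ] E →L[ℝ] ℝ} {u v : E} {DX DY : E →L[ℝ] E} {a : E →L[ℝ] ℝ}
  {Da : E →L[ℝ] E →L[ℝ] ℝ}

namespace HasJetAt

lemma endomorphism_apply (hF : HasJetAt (chartEndomorphism I F x) F₀ DF (extChartAt I x x))
    (hX : HasJetAt (chartVectorField I X x) u DX (extChartAt I x x)) :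
    HasJetAt (chartVectorField I (fun y ↦ F y (X y)) x) (F₀ u) (F₀.comp DX + DF.flip u)
      (extChartAt I x x) :=
  (hF.clm_apply hX).congr <| Filter.mem_of_superset (extChartAt_target_mem_nhds x)
    fun _ hy ↦ chartVectorField_endomorphism hy F X

lemma sharp_apply (hP : HasJetAt (chartSharp I P x) P₀ DP (extChartAt I x x))
    (hα : HasJetAt (chartOneForm I α x) a Da (extChartAt I x x)) :
    HasJetAt (chartVectorField I (fun y ↦ P y (α y)) x) (P₀ a) (P₀.comp Da + DP.flip a)
      (extChartAt I x x) :=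
  (hP.clm_apply hα).congr <| Filter.mem_of_superset (extChartAt_target_mem_nhds x)
    fun _ hy ↦ chartVectorField_sharp hy P α

lemma flat_apply (hσ : HasJetAt (chartTwoForm I σ x) σ₀ Dσ (extChartAt I x x))
    (hX : HasJetAt (chartVectorField I X x) u DX (extChartAt I x x)) :
    HasJetAt (chartOneForm I (fun y ↦ σ y (X y)) x) (σ₀ u) (σ₀.comp DX + Dσ.flip u)
      (extChartAt I x x) :=
  (hσ.clm_apply hX).congr <| Filter.mem_of_superset (extChartAt_target_mem_nhds x)
    fun _ hy ↦ chartOneForm_flat hy σ X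

lemma oneForm_comp (hα : HasJetAt (chartOneForm I α x) a Da (extChartAt I x x))
    (hF : HasJetAt (chartEndomorphism I F x) F₀ DF (extChartAt I x x)) :
    HasJetAt (chartOneForm I (fun y ↦ (α y).comp (F y)) x) (a.comp F₀)
      ((ContinuousLinearMap.compL ℝ E E ℝ a).comp DF
        + ((ContinuousLinearMap.compL ℝ E E ℝ).flip F₀).comp Da) (extChartAt I x x) :=
  (hα.clm_comp hF).congr <| Filter.mem_of_superset (extChartAt_target_mem_nhds x)
    fun _ hy ↦ chartOneForm_comp hy α F

lemma twoForm_comp (hσ : HasJetAt (chartTwoForm I σ x) σ₀ Dσ (extChartAt I x x))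
    (hF : HasJetAt (chartEndomorphism I F x) F₀ DF (extChartAt I x x)) :
    HasJetAt (chartTwoForm I (fun y ↦ (σ y).comp (F y)) x) (σ₀.comp F₀)
      ((ContinuousLinearMap.compL ℝ E E (E →L[ℝ] ℝ) σ₀).comp DF
        + ((ContinuousLinearMap.compL ℝ E E (E →L[ℝ] ℝ)).flip F₀).comp Dσ) (extChartAt I x x) :=
  (hσ.clm_comp hF).congr <| Filter.mem_of_superset (extChartAt_target_mem_nhds x)
    fun _ hy ↦ chartTwoForm_comp hy σ F

end HasJetAt

omit [I.Boundaryless] [IsManifold I ∞ M] in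
lemma mvfderiv_eq_of_hasFDerivAt {f : M → ℝ} {D : E →L[ℝ] ℝ}
    (hf : HasFDerivAt (fun y ↦ f ((extChartAt I x).symm y)) D (extChartAt I x x)) :
    mvfderiv I f x = D := by
  have hc : ContinuousAt f x := by
    refine (hf.continuousAt.comp (continuousAt_extChartAt x)).congr ?_
    filter_upwards [extChartAt_source_mem_nhds (I := I) x] with z hz
    exact congrArg f ((extChartAt I x).left_inv hz)
  have : HasMFDerivAt I 𝓘(ℝ, ℝ) f x D := ⟨hc, hf.hasFDerivWithinAt⟩
  exact this.mfderiv

lemma hasFDerivAt_oneForm_apply (hα : HasJetAt (chartOneForm I α x) a Da (extChartAt I x x))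
    (hX : HasJetAt (chartVectorField I X x) u DX (extChartAt I x x)) :
    HasFDerivAt (fun y ↦ α ((extChartAt I x).symm y) (X ((extChartAt I x).symm y)))
      (a.comp DX + Da.flip u) (extChartAt I x x) :=
  ((hα.clm_apply hX).congr <| Filter.mem_of_superset (extChartAt_target_mem_nhds x)
    fun _ hy ↦ (chartOneForm_apply_chartVectorField hy α X).symm).hasFDerivAt

lemma mvfderiv_oneForm_apply (hα : HasJetAt (chartOneForm I α x) a Da (extChartAt I x x))
    (hX : HasJetAt (chartVectorField I X x) u DX (extChartAt I x x)) (w : E) :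
    mvfderiv I (fun y ↦ α y (X y)) x w = Da w u + a (DX w) :=
  congr($(mvfderiv_eq_of_hasFDerivAt (hasFDerivAt_oneForm_apply hα hX)) w).trans (add_comm _ _)

lemma extDerivOne_apply (hα : HasJetAt (chartOneForm I α x) a Da (extChartAt I x x)) (v w : E) :
    extDerivOne I α x v w = Da v w - Da w v := by
  simp only [extDerivOne, I.range_eq_univ, fderivWithin_univ, hα.hasFDerivAt.fderiv]
  exact congr(Da $(chartDeriv_eq I x v) $(chartDeriv_eq I x w)
    - Da $(chartDeriv_eq I x w) $(chartDeriv_eq I x v))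

lemma extDerivTwo_apply (hσ : HasJetAt (chartTwoForm I σ x) σ₀ Dσ (extChartAt I x x))
    (u v w : E) : extDerivTwo I σ x u v w = Dσ u v w + Dσ v w u + Dσ w u v := by
  simp only [extDerivTwo, I.range_eq_univ, fderivWithin_univ, hσ.hasFDerivAt.fderiv]
  exact congr(Dσ $(chartDeriv_eq I x u) $(chartDeriv_eq I x v) $(chartDeriv_eq I x w)
    + Dσ $(chartDeriv_eq I x v) $(chartDeriv_eq I x w) $(chartDeriv_eq I x u)
    + Dσ $(chartDeriv_eq I x w) $(chartDeriv_eq I x u) $(chartDeriv_eq I x v))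

lemma lieOneForm_apply (hX : HasJetAt (chartVectorField I X x) u DX (extChartAt I x x))
    (hα : HasJetAt (chartOneForm I α x) a Da (extChartAt I x x)) (w : E) :
    lieOneForm I X α x w = Da u w + a (DX w) := by
  have hXx : X x = u := (chartVectorField_self I X x).symm.trans hX.value_eq
  calc lieOneForm I X α x w
      = extDerivOne I α x u w + mvfderiv I (fun y ↦ α y (X y)) x w := by rw [← hXx]; rfl
    _ = Da u w - Da w u + (Da w u + a (DX w)) := by
      rw [extDerivOne_apply hα, mvfderiv_oneForm_apply hα hX]
    _ = Da u w + a (DX w) := by ring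

lemma mpullbackWithin_extChartAt_symm_eventuallyEq (X : Π x : M, TangentSpace I x) :
    mpullbackWithin 𝓘(ℝ, E) I (extChartAt I x).symm X (Set.range I)
      =ᶠ[𝓝 (extChartAt I x x)] chartVectorField I X x := by
  have : IsManifold I 1 M := .of_le (n := ∞) (by simp)
  filter_upwards [extChartAt_target_mem_nhds (I := I) x] with y hy
  obtain ⟨e, he⟩ := isInvertible_mfderivWithin_extChartAt_symm (I := I) hy
  rw [mpullbackWithin_apply, ← he, ContinuousLinearMap.inverse_equiv]
  exact (ContinuousLinearEquiv.symm_apply_eq e).2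
    ((chartSymmDeriv_chartDerivAt I hy (X _)).symm.trans congr($he.symm _))

omit [I.Boundaryless] [IsManifold I ∞ M] in
lemma inverse_apply_of_eq_id {L : E →L[ℝ] E} (hL : L = .id ℝ E) (v : E) : L.inverse v = v := by
  simp [hL]

omit [I.Boundaryless] [IsManifold I ∞ M] in
lemma lieBracketWithin_eq_of_hasJetAt {V W V' W' : E → E} {s : Set E} {y : E} (hs : s = Set.univ)
    (hV : V =ᶠ[𝓝 y] V') (hW : W =ᶠ[𝓝 y] W') (hV' : HasJetAt V' u DX y) (hW' : HasJetAt W' v DY y) :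
    lieBracketWithin ℝ V W s y = DY u - DX v := by
  rw [hs, lieBracketWithin_univ, hV.lieBracket_vectorField_eq hW, lieBracket,
    hV'.hasFDerivAt.fderiv, hW'.hasFDerivAt.fderiv, hV'.value_eq, hW'.value_eq]

lemma mlieBracket_eq (hX : HasJetAt (chartVectorField I X x) u DX (extChartAt I x x))
    (hY : HasJetAt (chartVectorField I Y x) v DY (extChartAt I x x)) :
    mlieBracket I X Y x = DY u - DX v := by
  have : IsManifold I 1 M := .of_le (n := ∞) (by simp)
  exact mlieBracketWithin_apply.trans <|
    (inverse_apply_of_eq_id (E := E) mfderiv_extChartAt_self _).trans <|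
      lieBracketWithin_eq_of_hasJetAt (by simp [I.range_eq_univ])
        (mpullbackWithin_extChartAt_symm_eventuallyEq X)
        (mpullbackWithin_extChartAt_symm_eventuallyEq Y) hX hY

end ChartJets

section Smoothness

open Filter Topology Bundle FiberBundle

variable {E : Type*} [NormedAddCommGroup E] [NormedSpace ℝ E]
  {H : Type*} [TopologicalSpace H] {I : ModelWithCorners ℝ E H}
  {M : Type*} [TopologicalSpace M] [ChartedSpace H M]

lemma differentiableAt_comp_extChartAt_symm [I.Boundaryless] {G : Type*} [NormedAddCommGroup G]
    [NormedSpace ℝ G] {g : M → G} {x : M} (hg : ContMDiffAt I 𝓘(ℝ, G) ∞ g x) :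
    DifferentiableAt ℝ (fun y ↦ g ((extChartAt I x).symm y)) (extChartAt I x x) := by
  have h := (hg.mdifferentiableAt (by simp)).differentiableWithinAt_writtenInExtChartAt
  rw [I.range_eq_univ, differentiableWithinAt_univ] at h
  exact h

lemma extChartAt_symm_mem_chartAt_source {x : M} {y : E} (hy : y ∈ (extChartAt I x).target) :
    (extChartAt I x).symm y ∈ (chartAt H x).source :=
  extChartAt_source (H := H) I x ▸ (extChartAt I x).map_target hy

variable [IsManifold I ∞ M]

section Trivialization

variable {x : M} {y : E}

lemma continuousLinearMapAt_eq_chartDerivAt {z : M} (hz : z ∈ (chartAt H x).source) (v : E) :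
    (trivializationAt E (TangentSpace I) x).continuousLinearMapAt ℝ z v = chartDerivAt I x z v := by
  have : IsManifold I 1 M := .of_le (n := ∞) (by simp)
  exact congr(($(TangentBundle.continuousLinearMapAt_trivializationAt hz) : E →L[ℝ] E) v)

lemma symmL_eq_chartSymmDeriv (hy : y ∈ (extChartAt I x).target) (v : E) :
    (trivializationAt E (TangentSpace I) x).symmL ℝ ((extChartAt I x).symm y) v
      = chartSymmDeriv I x y v := by
  have : IsManifold I 1 M := .of_le (n := ∞) (by simp)
  have h := TangentBundle.symmL_trivializationAt (I := I) (extChartAt_symm_mem_chartAt_source hy)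
  refine congr(($h : E →L[ℝ] E) v).trans ?_
  exact congrArg (fun z ↦ (mfderivWithin 𝓘(ℝ, E) I (extChartAt I x).symm (Set.range I) z :
    E →L[ℝ] E) v) ((extChartAt I x).right_inv hy)

lemma inCoordinates_cotangent (hy : y ∈ (extChartAt I x).target)
    (a : Cotangent I ((extChartAt I x).symm y)) (v : E) :
    ContinuousLinearMap.inCoordinates E (TangentSpace I) ℝ (fun _ : M ↦ ℝ) x
      ((extChartAt I x).symm y) x ((extChartAt I x).symm y) a v = a (chartSymmDeriv I x y v) := by
  refine Eq.trans ?_ congr(a $(symmL_eq_chartSymmDeriv hy v))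
  simp only [ContinuousLinearMap.inCoordinates, Bundle.Trivial.fiberBundle_trivializationAt',
    Bundle.Trivial.continuousLinearMapAt_trivialization, ContinuousLinearMap.id_comp]
  rfl

lemma symmL_cotangent (hy : y ∈ (extChartAt I x).target) (α : E →L[ℝ] ℝ) :
    (trivializationAt (E →L[ℝ] ℝ) (fun x : M ↦ TangentSpace I x →L[ℝ] ℝ) x).symmL ℝ
      ((extChartAt I x).symm y) α = α.comp (chartDerivAt I x ((extChartAt I x).symm y)) := by
  have hb : (extChartAt I x).symm y ∈
      (trivializationAt (E →L[ℝ] ℝ) (fun x : M ↦ TangentSpace I x →L[ℝ] ℝ) x).baseSet :=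
    ⟨extChartAt_symm_mem_chartAt_source hy, Set.mem_univ _⟩
  let β : Cotangent I ((extChartAt I x).symm y) :=
    α.comp (chartDerivAt I x ((extChartAt I x).symm y))
  have hβ : (trivializationAt (E →L[ℝ] ℝ) (fun x : M ↦ TangentSpace I x →L[ℝ] ℝ)
      x).continuousLinearMapAt ℝ ((extChartAt I x).symm y) β = α := by
    rw [Trivialization.continuousLinearMapAt_apply, Trivialization.linearMapAt_apply, if_pos hb]
    ext v
    exact (inCoordinates_cotangent hy β v).trans
      (congrArg α (chartDerivAt_chartSymmDeriv I hy v))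
  exact congr(Trivialization.symmL ℝ _ _ $hβ).symm.trans
    (Trivialization.symmL_continuousLinearMapAt (R := ℝ) _ hb β)

end Trivialization

variable [I.Boundaryless]

lemma SmoothVectorField.differentiableAt {X : Π x : M, TangentSpace I x}
    (hX : SmoothVectorField I X) (x : M) :
    DifferentiableAt ℝ (chartVectorField I X x) (extChartAt I x x) := by
  have h := (contMDiffAt_section x).1 (hX x)
  refine (differentiableAt_comp_extChartAt_symm h).congr_of_eventuallyEq ?_
  filter_upwards [extChartAt_target_mem_nhds (I := I) x] with y hy
  have hz := extChartAt_symm_mem_chartAt_source hy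
  refine (continuousLinearMapAt_eq_chartDerivAt (E := E) hz (X _)).symm.trans ?_
  rw [Trivialization.continuousLinearMapAt_apply, Trivialization.linearMapAt_apply]
  exact if_pos hz

lemma SmoothEndomorphism.differentiableAt {F : Π x : M, TangentSpace I x →L[ℝ] TangentSpace I x}
    (hF : SmoothEndomorphism I F) (x : M) :
    DifferentiableAt ℝ (chartEndomorphism I F x) (extChartAt I x x) := by
  have h := differentiableAt_comp_extChartAt_symm ((contMDiffAt_hom_bundle _).1 (hF x)).2
  refine h.congr_of_eventuallyEq ?_
  filter_upwards [extChartAt_target_mem_nhds (I := I) x] with y hy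
  ext v
  exact (continuousLinearMapAt_eq_chartDerivAt (extChartAt_symm_mem_chartAt_source hy) _).symm.trans
    congr((trivializationAt E (TangentSpace I) x).continuousLinearMapAt ℝ _
      (F _ $(symmL_eq_chartSymmDeriv hy v))).symm

lemma SmoothOneForm.differentiableAt {α : Π x : M, Cotangent I x} (hα : SmoothOneForm I α)
    (x : M) : DifferentiableAt ℝ (chartOneForm I α x) (extChartAt I x x) := by
  have h := differentiableAt_comp_extChartAt_symm ((contMDiffAt_hom_bundle _).1 (hα x)).2
  refine h.congr_of_eventuallyEq ?_
  filter_upwards [extChartAt_target_mem_nhds (I := I) x] with y hy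
  ext v
  exact (inCoordinates_cotangent hy (α _) v).symm

lemma SmoothFlat.differentiableAt {σ : Π x : M, TangentSpace I x →L[ℝ] Cotangent I x}
    (hσ : SmoothFlat I σ) (x : M) :
    DifferentiableAt ℝ (chartTwoForm I σ x) (extChartAt I x x) := by
  have h := differentiableAt_comp_extChartAt_symm ((contMDiffAt_hom_bundle _).1 (hσ x)).2
  refine h.congr_of_eventuallyEq ?_
  filter_upwards [extChartAt_target_mem_nhds (I := I) x] with y hy
  have hb : (extChartAt I x).symm y ∈
      (trivializationAt E (TangentSpace I : M → Type _) x).baseSet :=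
    extChartAt_symm_mem_chartAt_source hy
  have hsymm (v : E) : chartSymmDeriv I x y v
      = (trivializationAt E (TangentSpace I) x).symm ((extChartAt I x).symm y) v :=
    (symmL_eq_chartSymmDeriv hy v).symm.trans (Trivialization.symmL_apply _ hb v)
  have htriv (r : ℝ) : (trivializationAt ℝ (fun _ : M ↦ ℝ) x).linearMapAt ℝ
      ((extChartAt I x).symm y) r = r :=
    congr($(Bundle.Trivial.linearMapAt_trivialization ℝ M ℝ _) r)
  ext u v
  refine Eq.trans ?_ ((inCoordinates_apply_eq₂ (𝕜 := ℝ) (F₃ := ℝ) (E₃ := fun _ : M ↦ ℝ)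
    (ϕ := σ ((extChartAt I x).symm y)) (v := u) (w := v) hb hb (Set.mem_univ _)).trans
      (htriv _)).symm
  exact congr(σ _ $(hsymm u) $(hsymm v))

lemma SmoothSharp.differentiableAt {P : Π x : M, Cotangent I x →L[ℝ] TangentSpace I x}
    (hP : SmoothSharp I P) (x : M) :
    DifferentiableAt ℝ (chartSharp I P x) (extChartAt I x x) := by
  have h := differentiableAt_comp_extChartAt_symm ((contMDiffAt_hom_bundle _).1 (hP x)).2
  refine h.congr_of_eventuallyEq ?_
  filter_upwards [extChartAt_target_mem_nhds (I := I) x] with y hy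
  ext α
  exact (continuousLinearMapAt_eq_chartDerivAt (extChartAt_symm_mem_chartAt_source hy) _).symm.trans
    congr((trivializationAt E (TangentSpace I) x).continuousLinearMapAt ℝ _
      (P _ $(symmL_cotangent hy α))).symm

lemma SmoothVectorField.exists_hasJetAt {X : Π x : M, TangentSpace I x}
    (hX : SmoothVectorField I X) (x : M) :
    ∃ DX, HasJetAt (chartVectorField I X x) (X x) DX (extChartAt I x x) :=
  ⟨_, chartVectorField_self I X x, (hX.differentiableAt x).hasFDerivAt⟩

lemma SmoothOneForm.exists_hasJetAt {α : Π x : M, Cotangent I x} (hα : SmoothOneForm I α)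
    (x : M) : ∃ Dα, HasJetAt (chartOneForm I α x) (α x) Dα (extChartAt I x x) :=
  ⟨_, chartOneForm_self I α x, (hα.differentiableAt x).hasFDerivAt⟩

end Smoothness

section Extension

open Bundle FiberBundle

variable {E : Type*} [NormedAddCommGroup E] [NormedSpace ℝ E] [FiniteDimensional ℝ E]
  {H : Type*} [TopologicalSpace H] {I : ModelWithCorners ℝ E H}
  {M : Type*} [TopologicalSpace M] [ChartedSpace H M] [IsManifold I ∞ M] [T2Space M] {x : M}

lemma exists_contMDiff_section_eq {F : Type*} [NormedAddCommGroup F] [NormedSpace ℝ F]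
    {V : M → Type*} [TopologicalSpace (TotalSpace F V)] [∀ x, AddCommGroup (V x)]
    [∀ x, Module ℝ (V x)] [∀ x, TopologicalSpace (V x)] [FiberBundle F V] [VectorBundle ℝ F V]
    [ContMDiffVectorBundle ∞ F V I] (v : V x) :
    ∃ s : Π x, V x, ContMDiff I (I.prod 𝓘(ℝ, F)) ∞ (fun x ↦ TotalSpace.mk' F x (s x)) ∧
      s x = v := by
  obtain ⟨u, hu, hs⟩ := exists_contMDiffOn_extend (k := ∞) I F v
  obtain ⟨u', hu', hu'o, hxu'⟩ := mem_nhds_iff.1 hu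
  obtain ⟨f, -, hf⟩ := (SmoothBumpFunction.nhds_basis_tsupport (I := I) x).mem_iff.1
    (hu'o.mem_nhds hxu')
  refine ⟨(f : M → ℝ) • FiberBundle.extend F v, ?_, ?_⟩
  · exact f.contMDiff.contMDiffOn.smul_section_of_tsupport hu'o hf (hs.mono hu')
  · simp

lemma exists_smoothVectorField_eq (v : TangentSpace I x) :
    ∃ X : Π x : M, TangentSpace I x, SmoothVectorField I X ∧ X x = v :=
  exists_contMDiff_section_eq v

lemma exists_smoothOneForm_eq (a : Cotangent I x) :
    ∃ α : Π x : M, Cotangent I x, SmoothOneForm I α ∧ α x = a :=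
  exists_contMDiff_section_eq (F := E →L[ℝ] ℝ) (V := fun x : M ↦ TangentSpace I x →L[ℝ] ℝ) a

end Extension

section ManifoldCourant

open Filter Topology

variable {E : Type*} [NormedAddCommGroup E] [NormedSpace ℝ E]
  {H : Type*} [TopologicalSpace H] (I : ModelWithCorners ℝ E H)
  {M : Type*} [TopologicalSpace M] [ChartedSpace H M]

/-- The identification of a fibre of `TM ⊕ T*M` with `E ⊕ E*` by the preferred chart at `x₀`. -/
def chartBig (x₀ : M) (y : E) : BigTangent I ((extChartAt I x₀).symm y) →L[ℝ] BigModel E :=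
  (chartDerivAt I x₀ ((extChartAt I x₀).symm y)).prodMap
    (ContinuousLinearMap.precomp ℝ (chartSymmDeriv I x₀ y))

/-- The inverse of `chartBig` on the target of the chart. -/
def chartBigSymm (x₀ : M) (y : E) : BigModel E →L[ℝ] BigTangent I ((extChartAt I x₀).symm y) :=
  (chartSymmDeriv I x₀ y).prodMap
    (ContinuousLinearMap.precomp ℝ (chartDerivAt I x₀ ((extChartAt I x₀).symm y)))

/-- The section `e` of `TM ⊕ T*M` read in the preferred chart at `x₀`. -/
def chartSection (e : Π x : M, BigTangent I x) (x₀ : M) (y : E) : BigModel E :=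
  chartBig I x₀ y (e ((extChartAt I x₀).symm y))

/-- The endomorphism `J` of `TM ⊕ T*M` read in the preferred chart at `x₀`. -/
def chartBigEndomorphism (J : Π x : M, BigTangent I x →L[ℝ] BigTangent I x) (x₀ : M) (y : E) :
    BigModel E →L[ℝ] BigModel E :=
  (chartBig I x₀ y).comp ((J ((extChartAt I x₀).symm y)).comp (chartBigSymm I x₀ y))

variable {I} {x₀ x : M} {y : E} {J : Π x : M, BigTangent I x →L[ℝ] BigTangent I x}

lemma dualPairing_chartBig (e : BigTangent I ((extChartAt I x₀).symm y)) (a : BigModel E) :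
    dualPairing (chartBig I x₀ y e) a = 2 * pairing I e (chartBigSymm I x₀ y a) := by
  calc dualPairing (chartBig I x₀ y e) a
      = e.2 (chartBigSymm I x₀ y a).1 + (chartBigSymm I x₀ y a).2 e.1 := rfl
    _ = 2 * pairing I e (chartBigSymm I x₀ y a) := by rw [pairing]; ring

lemma chartBigEndomorphism_skew
    (hJ : ∀ x e₁ e₂, pairing I (J x e₁) e₂ + pairing I e₁ (J x e₂) = 0) (a b : BigModel E) :
    dualPairing (chartBigEndomorphism I J x₀ y a) b
      = -dualPairing a (chartBigEndomorphism I J x₀ y b) := by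
  have hpair (a b : BigModel E) : dualPairing (chartBigEndomorphism I J x₀ y a) b
      = 2 * pairing I (J _ (chartBigSymm I x₀ y a)) (chartBigSymm I x₀ y b) :=
    dualPairing_chartBig _ b
  have hcomm (e₁ e₂ : BigTangent I ((extChartAt I x₀).symm y)) :
      pairing I e₁ e₂ = pairing I e₂ e₁ := by
    rw [pairing, pairing, add_comm]
  rw [dualPairing_comm a, hpair, hpair]
  linarith [hJ _ (chartBigSymm I x₀ y a) (chartBigSymm I x₀ y b),
    hcomm (chartBigSymm I x₀ y a) (J _ (chartBigSymm I x₀ y b))]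

variable [IsManifold I ∞ M]

lemma chartBig_chartBigSymm (hy : y ∈ (extChartAt I x₀).target) (a : BigModel E) :
    chartBig I x₀ y (chartBigSymm I x₀ y a) = a := by
  refine Prod.ext (chartDerivAt_chartSymmDeriv I hy a.1) ?_
  ext v
  exact congrArg a.2 (chartDerivAt_chartSymmDeriv I hy v)

lemma chartBigSymm_chartBig (hy : y ∈ (extChartAt I x₀).target)
    (e : BigTangent I ((extChartAt I x₀).symm y)) :
    chartBigSymm I x₀ y (chartBig I x₀ y e) = e :=
  Prod.ext (chartSymmDeriv_chartDerivAt I hy e.1) (comp_chartSymmDeriv_comp_chartDerivAt hy e.2)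

lemma chartSection_self (e : Π x : M, BigTangent I x) (x : M) :
    chartSection I e x (extChartAt I x x) = e x :=
  Prod.ext (chartVectorField_self I (fun z ↦ (e z).1) x) (chartOneForm_self I (fun z ↦ (e z).2) x)

lemma chartSection_endomorphism (hy : y ∈ (extChartAt I x₀).target)
    (e : Π x : M, BigTangent I x) :
    chartSection I (fun z ↦ J z (e z)) x₀ y
      = chartBigEndomorphism I J x₀ y (chartSection I e x₀ y) :=
  congr(chartBig I x₀ y (J _ $(chartBigSymm_chartBig hy (e _)))).symm

lemma chartBigEndomorphism_self (x : M) :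
    chartBigEndomorphism I J x (extChartAt I x x) = J x := by
  refine ContinuousLinearMap.ext fun a ↦ ?_
  let e : Π z : M, BigTangent I z := fun _ ↦ a
  exact (congrArg _ (chartSection_self e x).symm).trans <|
    (chartSection_endomorphism (mem_extChartAt_target x) e).symm.trans (chartSection_self _ x)

lemma chartBigEndomorphism_involutive (hy : y ∈ (extChartAt I x₀).target)
    (hJ : ∀ x e, J x (J x e) = e) (a : BigModel E) :
    chartBigEndomorphism I J x₀ y (chartBigEndomorphism I J x₀ y a) = a :=
  congr(chartBig I x₀ y (J _ $(chartBigSymm_chartBig hy _))).trans <|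
    congr(chartBig I x₀ y $(hJ _ _)).trans (chartBig_chartBigSymm hy a)

variable [I.Boundaryless] {e e₁ e₂ : Π x : M, BigTangent I x} {a b : BigModel E}
  {D D₁ D₂ : E →L[ℝ] BigModel E} {J₀ : BigModel E →L[ℝ] BigModel E}
  {DJ : E →L[ℝ] BigModel E →L[ℝ] BigModel E}

lemma dualPairing_courantBracket (h₁ : HasJetAt (chartSection I e₁ x) a D₁ (extChartAt I x x))
    (h₂ : HasJetAt (chartSection I e₂ x) b D₂ (extChartAt I x x)) (c : BigModel E) :
    dualPairing (V := E) (courantBracket I e₁ e₂ x) c = courantForm a b D₁ D₂ c := by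
  have hX₁ : HasJetAt (chartVectorField I (fun z ↦ (e₁ z).1) x) _ _ (extChartAt I x x) := h₁.fst
  have hX₂ : HasJetAt (chartVectorField I (fun z ↦ (e₂ z).1) x) _ _ (extChartAt I x x) := h₂.fst
  have hα₁ : HasJetAt (chartOneForm I (fun z ↦ (e₁ z).2) x) _ _ (extChartAt I x x) := h₁.snd
  have hα₂ : HasJetAt (chartOneForm I (fun z ↦ (e₂ z).2) x) _ _ (extChartAt I x x) := h₂.snd
  have hd := mvfderiv_eq_of_hasFDerivAt (f := fun z ↦ (e₂ z).2 (e₁ z).1 - (e₁ z).2 (e₂ z).1)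
    ((hasFDerivAt_oneForm_apply hα₂ hX₁).sub (hasFDerivAt_oneForm_apply hα₁ hX₂))
  calc dualPairing (V := E) (courantBracket I e₁ e₂ x) c
      = (lieOneForm I (fun y ↦ (e₁ y).1) (fun y ↦ (e₂ y).2) x c.1
          - lieOneForm I (fun y ↦ (e₂ y).1) (fun y ↦ (e₁ y).2) x c.1
          - (1 / 2 : ℝ) * mvfderiv I (fun y ↦ (e₂ y).2 (e₁ y).1 - (e₁ y).2 (e₂ y).1) x c.1)
        + c.2 (mlieBracket I (fun y ↦ (e₁ y).1) (fun y ↦ (e₂ y).1) x) := rfl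
    _ = ((D₂ a.1).2 c.1 + b.2 (D₁ c.1).1 - ((D₁ b.1).2 c.1 + a.2 (D₂ c.1).1)
          - (1 / 2) * (b.2 (D₁ c.1).1 + (D₂ c.1).2 a.1 - (a.2 (D₂ c.1).1 + (D₁ c.1).2 b.1)))
        + c.2 ((D₂ a.1).1 - (D₁ b.1).1) :=
      congr($(lieOneForm_apply hX₁ hα₂ c.1) - $(lieOneForm_apply hX₂ hα₁ c.1)
        - 1 / 2 * $hd c.1 + c.2 $(mlieBracket_eq hX₁ hX₂))
    _ = courantForm a b D₁ D₂ c := by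
      simp only [courantForm, dualPairing_apply, map_sub]
      ring

lemma HasJetAt.bigEndomorphism_apply
    (hJ : HasJetAt (chartBigEndomorphism I J x) J₀ DJ (extChartAt I x x))
    (he : HasJetAt (chartSection I e x) a D (extChartAt I x x)) :
    HasJetAt (chartSection I (fun y ↦ J y (e y)) x) (J₀ a) (J₀.comp D + DJ.flip a)
      (extChartAt I x x) :=
  (hJ.clm_apply he).congr <| Filter.mem_of_superset (extChartAt_target_mem_nhds x)
    fun _ hy ↦ chartSection_endomorphism hy e

lemma HasJetAt.isParaComplexJet
    (hJ : HasJetAt (chartBigEndomorphism I J x) J₀ DJ (extChartAt I x x))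
    (hinv : ∀ x e, J x (J x e) = e)
    (hskew : ∀ x e₁ e₂, pairing I (J x e₁) e₂ + pairing I e₁ (J x e₂) = 0) :
    IsParaComplexJet J₀ DJ := by
  rw [← hJ.value_eq]
  refine .of_hasFDerivAt hJ.hasFDerivAt ?_ (.of_forall fun y ↦ chartBigEndomorphism_skew hskew)
  filter_upwards [extChartAt_target_mem_nhds (I := I) x] with y hy
  exact chartBigEndomorphism_involutive hy hinv

lemma dualPairing_courantTorsion (hinv : ∀ x e, J x (J x e) = e)
    (hskew : ∀ x e₁ e₂, pairing I (J x e₁) e₂ + pairing I e₁ (J x e₂) = 0)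
    (hJ : HasJetAt (chartBigEndomorphism I J x) J₀ DJ (extChartAt I x x))
    (h₁ : HasJetAt (chartSection I e₁ x) a D₁ (extChartAt I x x))
    (h₂ : HasJetAt (chartSection I e₂ x) b D₂ (extChartAt I x x)) (c : BigModel E) :
    dualPairing (V := E) (courantBracket I (fun y ↦ J y (e₁ y)) (fun y ↦ J y (e₂ y)) x
      - J x (courantBracket I (fun y ↦ J y (e₁ y)) e₂ x
          + courantBracket I e₁ (fun y ↦ J y (e₂ y)) x)
      + courantBracket I e₁ e₂ x) c = torsionForm J₀ DJ a b c := by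
  have hjet := hJ.isParaComplexJet hinv hskew
  have hJx : J x = J₀ := (chartBigEndomorphism_self x).symm.trans hJ.value_eq
  have hsplit (n₁ n₂ n₃ n₄ : BigModel E) : dualPairing (n₁ - J₀ (n₂ + n₃) + n₄) c
      = dualPairing n₁ c + dualPairing n₂ (J₀ c) + dualPairing n₃ (J₀ c) + dualPairing n₄ c := by
    simp only [map_add, map_sub, add_apply, sub_apply, hjet.skew]
    ring
  have hJ₁ := hJ.bigEndomorphism_apply h₁
  have hJ₂ := hJ.bigEndomorphism_apply h₂
  rw [hJx]
  exact (hsplit _ _ _ _).trans <|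
    congr($(dualPairing_courantBracket hJ₁ hJ₂ c) + $(dualPairing_courantBracket hJ₁ h₂ (J₀ c))
      + $(dualPairing_courantBracket h₁ hJ₂ (J₀ c)) + $(dualPairing_courantBracket h₁ h₂ c)).trans
    (courantForm_torsion hjet a b c D₁ D₂)

lemma SmoothSection.exists_hasJetAt (he : SmoothSection I e) (x : M) :
    ∃ D, HasJetAt (chartSection I e x) (e x) D (extChartAt I x x) :=
  ⟨_, chartSection_self e x, ((SmoothVectorField.differentiableAt he.1 x).prodMk
    (SmoothOneForm.differentiableAt he.2 x)).hasFDerivAt⟩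

omit [I.Boundaryless] in
lemma exists_smoothSection_eq [FiniteDimensional ℝ E] [T2Space M] (a : BigTangent I x) :
    ∃ e : Π x : M, BigTangent I x, SmoothSection I e ∧ e x = a := by
  obtain ⟨X, hX, hXx⟩ := exists_smoothVectorField_eq a.1
  obtain ⟨α, hα, hαx⟩ := exists_smoothOneForm_eq a.2
  exact ⟨fun x ↦ (X x, α x), ⟨hX, hα⟩, Prod.ext hXx hαx⟩

theorem courantIntegrable_iff_torsionForm_eq_zero [FiniteDimensional ℝ E] [T2Space M]
    (hinv : ∀ x e, J x (J x e) = e)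
    (hskew : ∀ x e₁ e₂, pairing I (J x e₁) e₂ + pairing I e₁ (J x e₂) = 0)
    {J₀ : M → BigModel E →L[ℝ] BigModel E} {DJ : M → E →L[ℝ] BigModel E →L[ℝ] BigModel E}
    (hJ : ∀ x, HasJetAt (chartBigEndomorphism I J x) (J₀ x) (DJ x) (extChartAt I x x)) :
    CourantIntegrable I J ↔ ∀ x a b c, torsionForm (J₀ x) (DJ x) a b c = 0 := by
  constructor
  · intro h x a b c
    obtain ⟨e₁, he₁, rfl⟩ := exists_smoothSection_eq (I := I) (x := x) a
    obtain ⟨e₂, he₂, rfl⟩ := exists_smoothSection_eq (I := I) (x := x) b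
    obtain ⟨D₁, h₁⟩ := he₁.exists_hasJetAt x
    obtain ⟨D₂, h₂⟩ := he₂.exists_hasJetAt x
    rw [← dualPairing_courantTorsion hinv hskew (hJ x) h₁ h₂ c, h e₁ e₂ he₁ he₂ x]
    exact congr($(map_zero (dualPairing (V := E))) c)
  · intro h e₁ e₂ he₁ he₂ x
    obtain ⟨D₁, h₁⟩ := he₁.exists_hasJetAt x
    obtain ⟨D₂, h₂⟩ := he₂.exists_hasJetAt x
    exact eq_zero_of_forall_dualPairing_eq_zero (V := E) fun c ↦
      (dualPairing_courantTorsion hinv hskew (hJ x) h₁ h₂ c).trans (h x _ _ c)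

end ManifoldCourant

/-! ### The jet of the adapted structure -/

section ProductChart

variable {E : Type*} [NormedAddCommGroup E] [NormedSpace ℝ E]
  {H : Type*} [TopologicalSpace H] {I : ModelWithCorners ℝ E H}
  {M : Type*} [TopologicalSpace M] [ChartedSpace H M] {p : M × ℝ} {y : E × ℝ}

lemma fst_mem_extChartAt_target (hy : y ∈ (extChartAt (I.prod 𝓘(ℝ, ℝ)) p).target) :
    y.1 ∈ (extChartAt I p.1).target := by
  rw [extChartAt_prod] at hy
  exact hy.1

variable [IsManifold I ∞ M]

lemma chartDerivAt_prod {z : M × ℝ} (hz : z.1 ∈ (extChartAt I p.1).source) (v : E × ℝ) :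
    chartDerivAt (I.prod 𝓘(ℝ, ℝ)) p z v = ((chartDerivAt I p.1 z.1 v.1 : E), v.2) := by
  have : IsManifold I 1 M := .of_le (n := ∞) (by simp)
  rw [extChartAt_source] at hz
  have hφ : HasMFDerivAt I 𝓘(ℝ, E) (extChartAt I p.1) z.1 (chartDerivAt I p.1 z.1) :=
    (mdifferentiableAt_extChartAt hz).hasMFDerivAt
  have hprod := hφ.prodMap (p := z) (hasMFDerivAt_id (I := 𝓘(ℝ, ℝ)) z.2)
  have h : HasMFDerivAt (I.prod 𝓘(ℝ, ℝ)) 𝓘(ℝ, E × ℝ) (extChartAt (I.prod 𝓘(ℝ, ℝ)) p) z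
      ((chartDerivAt I p.1 z.1).prodMap (.id ℝ ℝ)) := by
    have hid : (mfderiv I 𝓘(ℝ, E) (extChartAt I p.1) z.1).prodMap
          (mfderiv 𝓘(ℝ, ℝ) 𝓘(ℝ, ℝ) id z.2)
        = (chartDerivAt I p.1 z.1).prodMap (.id ℝ ℝ) :=
      congrArg (ContinuousLinearMap.prodMap _) mfderiv_id
    exact ⟨hprod.1, (hprod.2.congr_fderiv hid).congr (fun _ _ ↦ rfl) rfl⟩
  exact congrArg (fun L : E × ℝ →L[ℝ] E × ℝ ↦ L v) h.mfderiv

lemma chartSymmDeriv_prod (hy : y ∈ (extChartAt (I.prod 𝓘(ℝ, ℝ)) p).target) (v : E × ℝ) :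
    chartSymmDeriv (I.prod 𝓘(ℝ, ℝ)) p y v = ((chartSymmDeriv I p.1 y.1 v.1 : E), v.2) := by
  have hy₁ := fst_mem_extChartAt_target hy
  refine Eq.trans (congrArg (chartSymmDeriv (I.prod 𝓘(ℝ, ℝ)) p y) (Eq.symm ?_)) <|
    chartSymmDeriv_chartDerivAt (I.prod 𝓘(ℝ, ℝ)) hy ((chartSymmDeriv I p.1 y.1 v.1 : E), v.2)
  exact (chartDerivAt_prod ((extChartAt I p.1).map_target hy₁) _).trans
    (Prod.ext (chartDerivAt_chartSymmDeriv I hy₁ v.1) rfl)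

lemma chartBig_bigVector (hy : y ∈ (extChartAt (I.prod 𝓘(ℝ, ℝ)) p).target)
    (u : E) (f : ℝ) (α : E →L[ℝ] ℝ) (g : ℝ) :
    chartBig (I.prod 𝓘(ℝ, ℝ)) p y (bigVector u f α g)
      = bigVector (E := E) (chartDerivAt I p.1 ((extChartAt I p.1).symm y.1) u) f
        (α.comp (chartSymmDeriv I p.1 y.1)) g := by
  have hz := (extChartAt I p.1).map_target (fst_mem_extChartAt_target hy)
  refine Prod.ext (chartDerivAt_prod (z := ((extChartAt I p.1).symm y.1, y.2)) hz (u, f))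
    (ContinuousLinearMap.ext fun v ↦ ?_)
  exact congrArg (bigVector u f α g).2 (chartSymmDeriv_prod hy v)

lemma chartBigSymm_bigVector (hy : y ∈ (extChartAt (I.prod 𝓘(ℝ, ℝ)) p).target)
    (u : E) (f : ℝ) (α : E →L[ℝ] ℝ) (g : ℝ) :
    chartBigSymm (I.prod 𝓘(ℝ, ℝ)) p y (bigVector u f α g)
      = bigVector (E := E) (chartSymmDeriv I p.1 y.1 u) f
        (α.comp (chartDerivAt I p.1 ((extChartAt I p.1).symm y.1))) g := by
  have hz := (extChartAt I p.1).map_target (fst_mem_extChartAt_target hy)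
  refine Prod.ext (chartSymmDeriv_prod hy (u, f)) (ContinuousLinearMap.ext fun v ↦ ?_)
  exact congrArg (bigVector u f α g).2
    (chartDerivAt_prod (z := ((extChartAt I p.1).symm y.1, y.2)) hz v)

end ProductChart

namespace GenAlmostParaContact

variable {E : Type*} [NormedAddCommGroup E] [NormedSpace ℝ E]
  {H : Type*} [TopologicalSpace H] {I : ModelWithCorners ℝ E H}
  {M : Type*} [TopologicalSpace M] [ChartedSpace H M] [IsManifold I ∞ M]
  (S : GenAlmostParaContact I M)

/-- The values at `x` of the tensors of `S`. -/
def tensors (x : M) : ContactTensors E := (S.F x, S.P x, S.σ x, S.Z x, S.ξ x)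

/-- The tensors of `S` read in the preferred chart at `x₀`. -/
def chartTensors (x₀ : M) (y : E) : ContactTensors E :=
  (chartEndomorphism I S.F x₀ y, chartSharp I S.P x₀ y, chartTwoForm I S.σ x₀ y,
    chartVectorField I S.Z x₀ y, chartOneForm I S.ξ x₀ y)

/-- The 1-jet at `x` of the tensors of `S`, read in the preferred chart at `x`. -/
def jet (x : M) : ContactJet E where
  val := S.tensors x
  deriv := fderiv ℝ (S.chartTensors x) (extChartAt I x x)

section Jet

variable [I.Boundaryless] (x : M)

lemma hasJetAt_chartTensors :
    HasJetAt (S.chartTensors x) (S.jet x).val (S.jet x).deriv (extChartAt I x x) where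
  value_eq := Prod.ext (chartEndomorphism_self I S.F x) <| Prod.ext (chartSharp_self I S.P x) <|
    Prod.ext (chartTwoForm_self I S.σ x) <| Prod.ext (chartVectorField_self I S.Z x)
      (chartOneForm_self I S.ξ x)
  hasFDerivAt := ((S.smooth_F.differentiableAt x).prodMk <|
    (S.smooth_P.differentiableAt x).prodMk <| (S.smooth_σ.differentiableAt x).prodMk <|
      (S.smooth_Z.differentiableAt x).prodMk (S.smooth_ξ.differentiableAt x)).hasFDerivAt

lemma hasJetAt_F :
    HasJetAt (chartEndomorphism I S.F x) (S.jet x).F (S.jet x).DF (extChartAt I x x) :=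
  (S.hasJetAt_chartTensors x).fst

lemma hasJetAt_P :
    HasJetAt (chartSharp I S.P x) (S.jet x).P (S.jet x).DP (extChartAt I x x) :=
  (S.hasJetAt_chartTensors x).snd.fst

lemma hasJetAt_σ :
    HasJetAt (chartTwoForm I S.σ x) (S.jet x).σ (S.jet x).Dσ (extChartAt I x x) :=
  (S.hasJetAt_chartTensors x).snd.snd.fst

lemma hasJetAt_Z :
    HasJetAt (chartVectorField I S.Z x) (S.jet x).Z (S.jet x).DZ (extChartAt I x x) :=
  (S.hasJetAt_chartTensors x).snd.snd.snd.fst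

lemma hasJetAt_ξ :
    HasJetAt (chartOneForm I S.ξ x) (S.jet x).ξ (S.jet x).Dξ (extChartAt I x x) :=
  (S.hasJetAt_chartTensors x).snd.snd.snd.snd

end Jet

section Adapted

variable [FiniteDimensional ℝ E]

lemma adapted_eq_adaptedEndo (p : M × ℝ) :
    (S.adapted p : BigModel (E × ℝ) →L[ℝ] BigModel (E × ℝ)) = adaptedEndo (S.tensors p.1) := by
  refine ContinuousLinearMap.ext fun e ↦ ?_
  have key (τ : ContactTensors E) (e : BigModel (E × ℝ)) (pr : E × ℝ →L[ℝ] E)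
      (ic : E →L[ℝ] E × ℝ) (d : E × ℝ →L[ℝ] ℝ) (t : E × ℝ) (hpr : ∀ v, pr v = v.1)
      (hic : ∀ u, ic u = (u, 0)) (hd : ∀ v, d v = v.2) (ht : t = (0, 1)) :
      ((ic (τ.F (pr e.1) + τ.P (e.2.comp ic) + e.2 t • τ.Z) - e.2 (ic τ.Z) • t,
        (τ.σ (pr e.1) - (e.2.comp ic).comp τ.F - d e.1 • τ.ξ).comp pr + τ.ξ (pr e.1) • d) :
          BigModel (E × ℝ)) = adaptedEndo τ e := by
    obtain rfl : pr = .fst ℝ E ℝ := ContinuousLinearMap.ext hpr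
    obtain rfl : ic = .inl ℝ E ℝ := ContinuousLinearMap.ext hic
    obtain rfl : d = .snd ℝ E ℝ := ContinuousLinearMap.ext hd
    subst ht
    conv_rhs => rw [eq_bigVector e, adaptedEndo_bigVector]
    refine Prod.ext ?_ (ContinuousLinearMap.ext fun v ↦ ?_) <;> simp
  exact (adapted_apply S p e).trans <| key (S.tensors p.1) e (projM I p) (inclM I p) (dt I p)
    (ddt I p) (projM_apply p) (inclM_apply p) (dt_apply p) (ddt_eq p)

lemma chartBigEndomorphism_adapted {p : M × ℝ} {y : E × ℝ}
    (hy : y ∈ (extChartAt (I.prod 𝓘(ℝ, ℝ)) p).target) :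
    chartBigEndomorphism (I.prod 𝓘(ℝ, ℝ)) S.adapted p y
      = adaptedEndo (S.chartTensors p.1 y.1) := by
  refine ContinuousLinearMap.ext fun e ↦ ?_
  rw [eq_bigVector e]
  generalize e.1.1 = u, e.1.2 = f, e.2.comp (.inl ℝ E ℝ) = α, e.2 (0, 1) = g
  have key (τ : ContactTensors E) (L L' : E →L[ℝ] E) :
      bigVector (L (τ.F (L' u) + τ.P (α.comp L) + g • τ.Z)) (-(α.comp L) τ.Z)
          ((τ.σ (L' u) - (α.comp L).comp τ.F - f • τ.ξ).comp L') (τ.ξ (L' u))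
        = adaptedEndo (L.comp (τ.F.comp L'), L.comp (τ.P.comp (.precomp ℝ L)),
            (ContinuousLinearMap.precomp ℝ L').comp (τ.σ.comp L'), L τ.Z, τ.ξ.comp L')
          (bigVector u f α g) := by
    rw [adaptedEndo_bigVector]
    congr 1
    simp only [map_add, map_smul]
    rfl
  let z := (extChartAt I p.1).symm y.1
  let q : M × ℝ := (z, y.2)
  have hsymm := chartBigSymm_bigVector hy u f α g
  have hadapted (b : BigModel (E × ℝ)) := congr($(S.adapted_eq_adaptedEndo q) b)
  have h := (congrArg (S.adapted q) hsymm).trans <| (hadapted _).trans <|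
    adaptedEndo_bigVector _ _ _ _ _
  exact (congrArg (chartBig (I.prod 𝓘(ℝ, ℝ)) p y) h).trans <|
    (chartBig_bigVector hy _ _ _ _).trans <|
      key (S.tensors z) (chartDerivAt I p.1 z) (chartSymmDeriv I p.1 y.1)

variable [I.Boundaryless]

lemma hasJetAt_adapted (p : M × ℝ) :
    HasJetAt (chartBigEndomorphism (I.prod 𝓘(ℝ, ℝ)) S.adapted p)
      (adaptedEndo (S.jet p.1).val) (S.jet p.1).derivEndo
      (extChartAt (I.prod 𝓘(ℝ, ℝ)) p p) := by
  have h := S.hasJetAt_chartTensors p.1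
  have hfst : HasFDerivAt (fun y : E × ℝ ↦ S.chartTensors p.1 y.1)
      ((S.jet p.1).deriv.comp (.fst ℝ E ℝ)) (extChartAt (I.prod 𝓘(ℝ, ℝ)) p p) :=
    h.hasFDerivAt.comp (f := Prod.fst) (extChartAt (I.prod 𝓘(ℝ, ℝ)) p p) hasFDerivAt_fst
  have hJ : HasJetAt (fun y : E × ℝ ↦ adaptedEndo (S.chartTensors p.1 y.1))
      (adaptedEndo (S.jet p.1).val) (S.jet p.1).derivEndo (extChartAt (I.prod 𝓘(ℝ, ℝ)) p p) :=
    ⟨congrArg adaptedEndo h.value_eq,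
      (adaptedEndo (E := E)).hasFDerivAt.comp (extChartAt (I.prod 𝓘(ℝ, ℝ)) p p) hfst⟩
  refine hJ.congr ?_
  filter_upwards [extChartAt_target_mem_nhds (I := I.prod 𝓘(ℝ, ℝ)) p] with y hy
  exact S.chartBigEndomorphism_adapted hy

lemma isParaContact_jet (x : M) : (S.jet x).IsParaContact :=
  (S.hasJetAt_adapted (x, 0)).isParaComplexJet S.adapted_adapted S.adapted_skew

theorem isNormal_iff_torsion_eq_zero [T2Space M] :
    S.IsNormal ↔ ∀ x a b c, (S.jet x).torsion a b c = 0 :=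
  (courantIntegrable_iff_torsionForm_eq_zero S.adapted_adapted S.adapted_skew
    S.hasJetAt_adapted).trans ⟨fun h x ↦ h (x, 0), fun h p ↦ h p.1⟩

end Adapted

end GenAlmostParaContact

/-! ### The conditions in terms of the jet -/

namespace GenAlmostParaContact

variable {E : Type*} [NormedAddCommGroup E] [NormedSpace ℝ E]
  {H : Type*} [TopologicalSpace H] {I : ModelWithCorners ℝ E H}
  {M : Type*} [TopologicalSpace M] [ChartedSpace H M] [IsManifold I ∞ M]
  (S : GenAlmostParaContact I M) (x : M)

lemma P_ξ : S.P x (S.ξ x) = 0 := by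
  simpa using congr($(S.map_ξ x).1)

lemma ξ_comp_F : (S.ξ x).comp (S.F x) = 0 := by
  simpa using congr($(S.map_ξ x).2)

lemma F_Z : S.F x (S.Z x) = 0 := by
  simpa using congr($(S.map_Z x).1)

lemma σ_Z : S.σ x (S.Z x) = 0 := by
  simpa using congr($(S.map_Z x).2)

lemma F_P (α : Cotangent I x) : S.F x (S.P x α) = S.P x (α.comp (S.F x)) := by
  simpa [← sub_eq_add_neg, sub_eq_zero] using congr($(S.sq x (0, α)).1)

lemma F_F (u : TangentSpace I x) :
    S.F x (S.F x u) = u - S.P x (S.σ x u) - S.ξ x u • S.Z x := by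
  have h : S.F x (S.F x u) + S.P x (S.σ x u) = u - S.ξ x u • S.Z x := by
    simpa using congr($(S.sq x (u, 0)).1)
  rw [sub_right_comm, ← h, add_sub_cancel_right]

end GenAlmostParaContact

section Evaluation

variable {E : Type*} [NormedAddCommGroup E] [NormedSpace ℝ E]

lemma eq_iff_forall_dual_sub_eq {u v : E} {D : (E →L[ℝ] ℝ) → ℝ} (h : ∀ γ, γ u - γ v = D γ) :
    u = v ↔ ∀ γ, D γ = 0 := by
  rw [SeparatingDual.eq_iff_forall_dual_eq (R := ℝ)]
  simp only [← h, sub_eq_zero]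

lemma covector_eq_iff_forall_sub_eq {α β : E →L[ℝ] ℝ} {D : E → ℝ}
    (h : ∀ u, α u - β u = D u) : α = β ↔ ∀ u, D u = 0 := by
  simp only [← h, sub_eq_zero, ContinuousLinearMap.ext_iff]

end Evaluation

namespace GenAlmostParaContact

open ContinuousLinearMap (comp_apply flip_apply compL_apply)

variable {E : Type*} [NormedAddCommGroup E] [NormedSpace ℝ E]
  {H : Type*} [TopologicalSpace H] {I : ModelWithCorners ℝ E H} [I.Boundaryless]
  {M : Type*} [TopologicalSpace M] [ChartedSpace H M] [IsManifold I ∞ M]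
  (S : GenAlmostParaContact I M) {x : M} {X Y : Π x : M, TangentSpace I x}
  {α β : Π x : M, Cotangent I x} {u v : E} {DX DY : E →L[ℝ] E} {a b : E →L[ℝ] ℝ}
  {Da Db : E →L[ℝ] E →L[ℝ] ℝ}

section VectorFields

variable (hX : HasJetAt (chartVectorField I X x) u DX (extChartAt I x x))
include hX

lemma lieEndomorphism_Z_F_apply (γ : E →L[ℝ] ℝ) :
    γ (lieEndomorphism I S.Z S.F X x) = (S.jet x).lieZF u γ := by
  have h₁ := mlieBracket_eq (S.hasJetAt_Z x) ((S.hasJetAt_F x).endomorphism_apply hX)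
  have h₂ := mlieBracket_eq (S.hasJetAt_Z x) hX
  refine congr((fun w₁ w₂ : E ↦ γ (w₁ - (S.jet x).F w₂)) $h₁ $h₂).trans ?_
  simp only [add_apply, comp_apply, flip_apply, map_sub, map_add, ContactJet.lieZF]
  ring

lemma lieFlat_Z_σ_apply (v : E) : lieFlat I S.Z S.σ X x v = (S.jet x).lieZσ u v := by
  have h₁ := lieOneForm_apply (S.hasJetAt_Z x) ((S.hasJetAt_σ x).flat_apply hX) v
  have h₂ := mlieBracket_eq (S.hasJetAt_Z x) hX
  refine congr((fun (r : ℝ) (w : E) ↦ r - (S.jet x).σ w v) $h₁ $h₂).trans ?_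
  simp only [add_apply, sub_apply, comp_apply, flip_apply, map_sub, ContactJet.lieZσ]
  ring

lemma lieOneForm_F_ξ_apply (v : E) :
    lieOneForm I (fun y ↦ S.F y (X y)) S.ξ x v
      = (S.jet x).Dξ ((S.jet x).F u) v + (S.jet x).ξ ((S.jet x).DF v u) := by
  have hξF (w : E) : (S.jet x).ξ ((S.jet x).F w) = 0 := congr($(S.ξ_comp_F x) w)
  refine (lieOneForm_apply ((S.hasJetAt_F x).endomorphism_apply hX) (S.hasJetAt_ξ x) v).trans ?_
  simp only [add_apply, comp_apply, flip_apply, map_add, hξF, zero_add]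

lemma nijenhuis_F_apply (hY : HasJetAt (chartVectorField I Y x) v DY (extChartAt I x x))
    (γ : E →L[ℝ] ℝ) :
    γ (nijenhuis I S.F X Y x)
      = γ ((S.jet x).DF ((S.jet x).F u) v) - γ ((S.jet x).DF ((S.jet x).F v) u)
        + γ ((S.jet x).F ((S.jet x).DF v u)) - γ ((S.jet x).F ((S.jet x).DF u v)) := by
  have hFX := (S.hasJetAt_F x).endomorphism_apply hX
  have hFY := (S.hasJetAt_F x).endomorphism_apply hY
  have h₁ := mlieBracket_eq hFX hFY
  have h₂ := mlieBracket_eq hX hY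
  have h₃ := mlieBracket_eq hFX hY
  have h₄ := mlieBracket_eq hX hFY
  refine congr((fun w₁ w₂ w₃ w₄ : E ↦ γ (w₁ + (S.jet x).F ((S.jet x).F w₂) - (S.jet x).F w₃
    - (S.jet x).F w₄)) $h₁ $h₂ $h₃ $h₄).trans ?_
  simp only [add_apply, comp_apply, flip_apply, map_sub, map_add]
  ring

lemma nijenhuis_F_eq_iff (hY : HasJetAt (chartVectorField I Y x) v DY (extChartAt I x x)) :
    nijenhuis I S.F X Y x = S.P x (extDerivTwo I S.σ x u v) + extDerivOne I S.ξ x u v • S.Z x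
      ↔ ∀ γ, (S.jet x).nijenhuisDefect u v γ = 0 := by
  refine eq_iff_forall_dual_sub_eq (E := E) fun γ ↦ ?_
  have h₁ := S.nijenhuis_F_apply hX hY γ
  have h₂ := extDerivTwo_apply (S.hasJetAt_σ x) u v ((S.jet x).P γ)
  have h₃ := extDerivOne_apply (S.hasJetAt_ξ x) u v
  have h₄ := (S.P_skew x (extDerivTwo I S.σ x u v) γ).trans congr(-$h₂)
  have hγ (w : E) (r : ℝ) : γ (w + r • (S.jet x).Z) = γ w + r * γ (S.jet x).Z := by simp
  refine congr($h₁ - $((hγ _ _).trans congr($h₄ + $h₃ * γ (S.jet x).Z))).trans ?_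
  simp only [ContactJet.nijenhuisDefect, ContactJet.dσ]
  ring

end VectorFields

section Forms

variable [FiniteDimensional ℝ E] (hα : HasJetAt (chartOneForm I α x) a Da (extChartAt I x x))
include hα

omit [FiniteDimensional ℝ E] in
lemma lieOneForm_P_ξ_apply (u : E) :
    lieOneForm I (fun y ↦ S.P y (α y)) S.ξ x u = (S.jet x).liePξ a u := by
  have hξP (b : E →L[ℝ] ℝ) : (S.jet x).ξ ((S.jet x).P b) = 0 :=
    (S.P_skew x b (S.ξ x)).trans (neg_eq_zero.2 (congr(b $(S.P_ξ x)).trans (map_zero b)))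
  refine (lieOneForm_apply ((S.hasJetAt_P x).sharp_apply hα) (S.hasJetAt_ξ x) u).trans ?_
  simp only [add_apply, comp_apply, flip_apply, map_add, hξP, zero_add, ContactJet.liePξ]

variable (hβ : HasJetAt (chartOneForm I β x) b Db (extChartAt I x x))
include hβ

lemma formBracket_P_apply (u : E) :
    formBracket I S.P α β x u
      = Db ((S.jet x).P a) u - Da ((S.jet x).P b) u + b ((S.jet x).DP u a) := by
  have hj := S.isParaContact_jet x
  have hPα := (S.hasJetAt_P x).sharp_apply hα
  have hPβ := (S.hasJetAt_P x).sharp_apply hβ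
  have h₁ := lieOneForm_apply hPα hβ u
  have h₂ := lieOneForm_apply hPβ hα u
  have h₃ := mvfderiv_oneForm_apply hβ hPα u
  refine congr($h₁ - $h₂ - $h₃).trans ?_
  simp only [add_apply, comp_apply, flip_apply, map_add]
  linear_combination -hj.P_skew (Db u) a - hj.DP_skew u b a

lemma lieBivector_Z_P_eq : lieBivector I S.Z S.P α β x = (S.jet x).lieZP a b := by
  have hj := S.isParaContact_jet x
  have h₀ : lieBivector I S.Z S.P α β x
      = mvfderiv I (fun y ↦ β y (S.P y (α y))) x (S.jet x).Z
        - b ((S.jet x).P (lieOneForm I S.Z α x)) - lieOneForm I S.Z β x ((S.jet x).P a) := by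
    rw [← hα.value_eq, ← hβ.value_eq, chartOneForm_self, chartOneForm_self]
    rfl
  have h₁ := mvfderiv_oneForm_apply hβ ((S.hasJetAt_P x).sharp_apply hα) (S.jet x).Z
  have h₂ := lieOneForm_apply (S.hasJetAt_Z x) hα ((S.jet x).P b)
  have h₃ := lieOneForm_apply (S.hasJetAt_Z x) hβ ((S.jet x).P a)
  have h₄ := (hj.P_skew (lieOneForm I S.Z α x) b).trans congr(-$h₂)
  refine h₀.trans (congr($h₁ - $h₄ - $h₃).trans ?_)
  simp only [add_apply, comp_apply, flip_apply, map_add, ContactJet.lieZP]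
  linear_combination hj.P_skew (Da (S.jet x).Z) b

lemma mlieBracket_P_eq_iff :
    mlieBracket I (fun y ↦ S.P y (α y)) (fun y ↦ S.P y (β y)) x
        = S.P x (formBracket I S.P α β x) ↔ ∀ γ, (S.jet x).schouten a b γ = 0 := by
  refine eq_iff_forall_dual_sub_eq (E := E) fun γ ↦ ?_
  have hj := S.isParaContact_jet x
  have h₁ := mlieBracket_eq ((S.hasJetAt_P x).sharp_apply hα) ((S.hasJetAt_P x).sharp_apply hβ)
  have h₂ := (S.P_skew x (formBracket I S.P α β x) γ).trans
    congr(-$(S.formBracket_P_apply hα hβ ((S.jet x).P γ)))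
  refine congr((fun (w : E) (r : ℝ) ↦ γ w - r) $h₁ $h₂).trans ?_
  simp only [add_apply, comp_apply, flip_apply, map_add, map_sub, ContactJet.schouten]
  linear_combination hj.P_skew (Db ((S.jet x).P a)) γ - hj.P_skew (Da ((S.jet x).P b)) γ

lemma formBracket_P_comp_F_eq_iff :
    (formBracket I S.P α β x).comp (S.F x)
        = lieOneForm I (fun y ↦ S.P y (α y)) (fun y ↦ (β y).comp (S.F y)) x
          - lieOneForm I (fun y ↦ S.P y (β y)) (fun y ↦ (α y).comp (S.F y)) x
          + mvfderiv I (fun y ↦ ((α y).comp (S.F y)) (S.P y (β y))) x ↔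
      ∀ u, (S.jet x).concomitant a b u = 0 := by
  refine covector_eq_iff_forall_sub_eq (E := E) fun u ↦ ?_
  have hj := S.isParaContact_jet x
  have hF_P (c : E →L[ℝ] ℝ) : (S.jet x).F ((S.jet x).P c) = (S.jet x).P (c.comp (S.jet x).F) :=
    S.F_P x c
  have hPα := (S.hasJetAt_P x).sharp_apply hα
  have hPβ := (S.hasJetAt_P x).sharp_apply hβ
  have hαF := hα.oneForm_comp (S.hasJetAt_F x)
  have h₁ := S.formBracket_P_apply hα hβ ((S.jet x).F u)
  have h₂ := lieOneForm_apply hPα (hβ.oneForm_comp (S.hasJetAt_F x)) u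
  have h₃ := lieOneForm_apply hPβ hαF u
  have h₄ := mvfderiv_oneForm_apply hαF hPβ u
  refine congr($h₁ - ($h₂ - $h₃ + $h₄)).trans ?_
  have h₅ : b ((S.jet x).P ((Da u).comp (S.jet x).F))
      = -(Da u) ((S.jet x).P (b.comp (S.jet x).F)) := by
    rw [hj.P_skew, comp_apply, hF_P]
  simp only [add_apply, comp_apply, flip_apply, compL_apply, map_add, hF_P,
    ContactJet.concomitant]
  linear_combination -h₅

end Forms

lemma extDerivTwo_σ_F_eq_iff (u v w : E) :
    extDerivTwo I (fun y ↦ (S.σ y).comp (S.F y)) x u v w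
      = extDerivTwo I S.σ x (S.F x u) v w + extDerivTwo I S.σ x u (S.F x v) w
        + extDerivTwo I S.σ x u v (S.F x w) ↔ (S.jet x).exteriorDefect u v w = 0 := by
  have hσ := S.hasJetAt_σ x
  have h₀ := extDerivTwo_apply (hσ.twoForm_comp (S.hasJetAt_F x)) u v w
  have h₁ := extDerivTwo_apply hσ ((S.jet x).F u) v w
  have h₂ := extDerivTwo_apply hσ u ((S.jet x).F v) w
  have h₃ := extDerivTwo_apply hσ u v ((S.jet x).F w)
  rw [eq_comm, ← sub_eq_zero]
  refine iff_of_eq (congrArg (· = 0) (congr($h₁ + $h₂ + $h₃ - $h₀).trans ?_))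
  simp only [add_apply, comp_apply, flip_apply, compL_apply, ContactJet.exteriorDefect,
    ContactJet.dσ, ContactJet.dσF]
  ring

end GenAlmostParaContact

section Extension

variable {M : Type*} {V : M → Type*} {Sm : (Π x, V x) → Prop}
  (exists_section : ∀ x (v : V x), ∃ s, Sm s ∧ s x = v)
include exists_section

lemma forall_section_iff {C : (Π x, V x) → M → Prop} {Q : ∀ x, V x → Prop}
    (h : ∀ s, Sm s → ∀ x, C s x ↔ Q x (s x)) :
    (∀ s, Sm s → ∀ x, C s x) ↔ ∀ x v, Q x v := by
  refine ⟨fun hC x v ↦ ?_, fun hQ s hs x ↦ (h s hs x).2 (hQ x _)⟩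
  obtain ⟨s, hs, rfl⟩ := exists_section x v
  exact (h s hs x).1 (hC s hs x)

lemma forall_section₂_iff {C : (Π x, V x) → (Π x, V x) → M → Prop} {Q : ∀ x, V x → V x → Prop}
    (h : ∀ s s', Sm s → Sm s' → ∀ x, C s s' x ↔ Q x (s x) (s' x)) :
    (∀ s s', Sm s → Sm s' → ∀ x, C s s' x) ↔ ∀ x v v', Q x v v' := by
  refine ⟨fun hC x v v' ↦ ?_, fun hQ s s' hs hs' x ↦ (h s s' hs hs' x).2 (hQ x _ _)⟩
  obtain ⟨s, hs, rfl⟩ := exists_section x v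
  obtain ⟨s', hs', rfl⟩ := exists_section x v'
  exact (h s s' hs hs' x).1 (hC s s' hs hs' x)

end Extension

namespace GenAlmostParaContact

variable {E : Type*} [NormedAddCommGroup E] [NormedSpace ℝ E] [FiniteDimensional ℝ E]
  {H : Type*} [TopologicalSpace H] {I : ModelWithCorners ℝ E H} [I.Boundaryless]
  {M : Type*} [TopologicalSpace M] [T2Space M] [ChartedSpace H M] [IsManifold I ∞ M]
  (S : GenAlmostParaContact I M)

lemma forall_mlieBracket_P_eq_iff :
    (∀ α β : Π x : M, Cotangent I x, SmoothOneForm I α → SmoothOneForm I β → ∀ x : M,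
      mlieBracket I (fun y ↦ S.P y (α y)) (fun y ↦ S.P y (β y)) x
        = S.P x (formBracket I S.P α β x)) ↔
      ∀ x α β γ, (S.jet x).schouten α β γ = 0 := by
  refine forall_section₂_iff (fun _ ↦ exists_smoothOneForm_eq) fun α β hα hβ x ↦ ?_
  obtain ⟨Dα, hα⟩ := hα.exists_hasJetAt x
  obtain ⟨Dβ, hβ⟩ := hβ.exists_hasJetAt x
  exact S.mlieBracket_P_eq_iff hα hβ

lemma forall_formBracket_P_comp_F_eq_iff :
    (∀ α β : Π x : M, Cotangent I x, SmoothOneForm I α → SmoothOneForm I β → ∀ x : M,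
      (formBracket I S.P α β x).comp (S.F x)
        = lieOneForm I (fun y ↦ S.P y (α y)) (fun y ↦ (β y).comp (S.F y)) x
          - lieOneForm I (fun y ↦ S.P y (β y)) (fun y ↦ (α y).comp (S.F y)) x
          + mvfderiv I (fun y ↦ ((α y).comp (S.F y)) (S.P y (β y))) x) ↔
      ∀ x α β u, (S.jet x).concomitant α β u = 0 := by
  refine forall_section₂_iff (fun _ ↦ exists_smoothOneForm_eq) fun α β hα hβ x ↦ ?_
  obtain ⟨Dα, hα⟩ := hα.exists_hasJetAt x
  obtain ⟨Dβ, hβ⟩ := hβ.exists_hasJetAt x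
  exact S.formBracket_P_comp_F_eq_iff hα hβ

lemma forall_nijenhuis_F_eq_iff :
    (∀ X Y : Π x : M, TangentSpace I x, SmoothVectorField I X → SmoothVectorField I Y → ∀ x : M,
      nijenhuis I S.F X Y x
        = S.P x (extDerivTwo I S.σ x (X x) (Y x)) + extDerivOne I S.ξ x (X x) (Y x) • S.Z x) ↔
      ∀ x u v γ, (S.jet x).nijenhuisDefect u v γ = 0 := by
  refine forall_section₂_iff (fun _ ↦ exists_smoothVectorField_eq) fun X Y hX hY x ↦ ?_
  obtain ⟨DX, hX⟩ := hX.exists_hasJetAt x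
  obtain ⟨DY, hY⟩ := hY.exists_hasJetAt x
  exact S.nijenhuis_F_eq_iff hX hY

lemma forall_lieOneForm_F_ξ_sub_eq_zero_iff :
    (∀ X Y : Π x : M, TangentSpace I x, SmoothVectorField I X → SmoothVectorField I Y → ∀ x : M,
      lieOneForm I (fun y ↦ S.F y (X y)) S.ξ x (Y x)
        - lieOneForm I (fun y ↦ S.F y (Y y)) S.ξ x (X x) = 0) ↔
      ∀ x u v, (S.jet x).lieFξ u v = 0 := by
  refine forall_section₂_iff (fun _ ↦ exists_smoothVectorField_eq) fun X Y hX hY x ↦ ?_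
  obtain ⟨DX, hX⟩ := hX.exists_hasJetAt x
  obtain ⟨DY, hY⟩ := hY.exists_hasJetAt x
  exact iff_of_eq congr($(S.lieOneForm_F_ξ_apply hX (Y x)) - $(S.lieOneForm_F_ξ_apply hY (X x)) = 0)

omit [FiniteDimensional ℝ E] [T2Space M] in
lemma forall_extDerivTwo_σ_F_eq_iff :
    (∀ (x : M) (u v w : TangentSpace I x),
      extDerivTwo I (fun y ↦ (S.σ y).comp (S.F y)) x u v w
        = extDerivTwo I S.σ x (S.F x u) v w + extDerivTwo I S.σ x u (S.F x v) w
          + extDerivTwo I S.σ x u v (S.F x w)) ↔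
      ∀ x u v w, (S.jet x).exteriorDefect u v w = 0 :=
  forall₄_congr fun _ ↦ S.extDerivTwo_σ_F_eq_iff

lemma forall_lieBivector_Z_P_eq_zero_iff :
    (∀ α β : Π x : M, Cotangent I x, SmoothOneForm I α → SmoothOneForm I β → ∀ x : M,
      lieBivector I S.Z S.P α β x = 0) ↔ ∀ x α β, (S.jet x).lieZP α β = 0 := by
  refine forall_section₂_iff (fun _ ↦ exists_smoothOneForm_eq) fun α β hα hβ x ↦ ?_
  obtain ⟨Dα, hα⟩ := hα.exists_hasJetAt x
  obtain ⟨Dβ, hβ⟩ := hβ.exists_hasJetAt x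
  exact iff_of_eq congr($(S.lieBivector_Z_P_eq hα hβ) = 0)

lemma forall_lieEndomorphism_Z_F_eq_zero_iff :
    (∀ X : Π x : M, TangentSpace I x, SmoothVectorField I X → ∀ x : M,
      lieEndomorphism I S.Z S.F X x = 0) ↔ ∀ x u γ, (S.jet x).lieZF u γ = 0 := by
  refine forall_section_iff (fun _ ↦ exists_smoothVectorField_eq) fun X hX x ↦ ?_
  obtain ⟨DX, hX⟩ := hX.exists_hasJetAt x
  refine eq_iff_forall_dual_sub_eq (E := E) fun γ ↦ ?_
  exact congr($(S.lieEndomorphism_Z_F_apply hX γ) - $(map_zero γ)).trans (sub_zero _)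

lemma forall_lieFlat_Z_σ_eq_zero_iff :
    (∀ X : Π x : M, TangentSpace I x, SmoothVectorField I X → ∀ x : M,
      lieFlat I S.Z S.σ X x = 0) ↔ ∀ x u v, (S.jet x).lieZσ u v = 0 := by
  refine forall_section_iff (fun _ ↦ exists_smoothVectorField_eq) fun X hX x ↦ ?_
  obtain ⟨DX, hX⟩ := hX.exists_hasJetAt x
  refine covector_eq_iff_forall_sub_eq (E := E) fun v ↦ ?_
  exact (sub_zero _).trans (S.lieFlat_Z_σ_apply hX v)

lemma forall_lieOneForm_P_ξ_eq_zero_iff :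
    (∀ α : Π x : M, Cotangent I x, SmoothOneForm I α → ∀ x : M,
      lieOneForm I (fun y ↦ S.P y (α y)) S.ξ x = 0) ↔ ∀ x α u, (S.jet x).liePξ α u = 0 := by
  refine forall_section_iff (fun _ ↦ exists_smoothOneForm_eq) fun α hα x ↦ ?_
  obtain ⟨Dα, hα⟩ := hα.exists_hasJetAt x
  refine covector_eq_iff_forall_sub_eq (E := E) fun u ↦ ?_
  exact (sub_zero _).trans (S.lieOneForm_P_ξ_apply hα u)

omit [FiniteDimensional ℝ E] [T2Space M] in
lemma lieOneForm_Z_ξ_eq_zero_iff {x : M} :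
    lieOneForm I S.Z S.ξ x = 0 ↔ ∀ u, (S.jet x).lieZξ u = 0 :=
  covector_eq_iff_forall_sub_eq (E := E) fun u ↦
    (sub_zero _).trans (lieOneForm_apply (S.hasJetAt_Z x) (S.hasJetAt_ξ x) u)

end GenAlmostParaContact

end ParaContact

end

open ParaContact in
theorem theorem3p1_general
    {E : Type*} [NormedAddCommGroup E] [NormedSpace ℝ E] [FiniteDimensional ℝ E]
    {H : Type*} [TopologicalSpace H] {I : ModelWithCorners ℝ E H} [I.Boundaryless]
    {M : Type*} [TopologicalSpace M] [T2Space M] [ChartedSpace H M] [IsManifold I ∞ M]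
    (S : GenAlmostParaContact I M) :
    S.IsNormal ↔
      (∀ α β : Π x : M, Cotangent I x,
        SmoothOneForm I α → SmoothOneForm I β → ∀ x : M,
        mlieBracket I (fun y ↦ S.P y (α y)) (fun y ↦ S.P y (β y)) x
          = S.P x (formBracket I S.P α β x)) ∧
      ((∀ (x : M) (α : Cotangent I x), S.F x (S.P x α) = S.P x (α.comp (S.F x))) ∧
       (∀ α β : Π x : M, Cotangent I x,
        SmoothOneForm I α → SmoothOneForm I β → ∀ x : M,
        (formBracket I S.P α β x).comp (S.F x)
          = lieOneForm I (fun y ↦ S.P y (α y)) (fun y ↦ (β y).comp (S.F y)) x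
            - lieOneForm I (fun y ↦ S.P y (β y)) (fun y ↦ (α y).comp (S.F y)) x
            + mvfderiv I (fun y ↦ ((α y).comp (S.F y)) (S.P y (β y))) x)) ∧
      ((∀ x : M, S.σ x (S.Z x) = 0) ∧
       (∀ x : M, S.P x (S.ξ x) = 0) ∧
       (∀ (x : M) (u : TangentSpace I x),
        S.F x (S.F x u) = u - S.P x (S.σ x u) - S.ξ x u • S.Z x) ∧
       (∀ X Y : Π x : M, TangentSpace I x,
        SmoothVectorField I X → SmoothVectorField I Y → ∀ x : M,
        nijenhuis I S.F X Y x
          = S.P x (extDerivTwo I S.σ x (X x) (Y x))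
            + extDerivOne I S.ξ x (X x) (Y x) • S.Z x)) ∧
      ((∀ x : M, S.F x (S.Z x) = 0) ∧
       (∀ x : M, (S.ξ x).comp (S.F x) = 0) ∧
       (∀ X Y : Π x : M, TangentSpace I x,
        SmoothVectorField I X → SmoothVectorField I Y → ∀ x : M,
        lieOneForm I (fun y ↦ S.F y (X y)) S.ξ x (Y x)
          - lieOneForm I (fun y ↦ S.F y (Y y)) S.ξ x (X x) = 0) ∧
       (∀ (x : M) (u v w : TangentSpace I x),
        extDerivTwo I (fun y ↦ (S.σ y).comp (S.F y)) x u v w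
          = extDerivTwo I S.σ x (S.F x u) v w
            + extDerivTwo I S.σ x u (S.F x v) w
            + extDerivTwo I S.σ x u v (S.F x w))) ∧
      ((∀ x : M, lieOneForm I S.Z S.ξ x = 0) ∧
       (∀ α β : Π x : M, Cotangent I x,
        SmoothOneForm I α → SmoothOneForm I β → ∀ x : M,
        lieBivector I S.Z S.P α β x = 0) ∧
       (∀ X : Π x : M, TangentSpace I x, SmoothVectorField I X → ∀ x : M,
        lieEndomorphism I S.Z S.F X x = 0) ∧
       (∀ X : Π x : M, TangentSpace I x, SmoothVectorField I X → ∀ x : M,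
        lieFlat I S.Z S.σ X x = 0) ∧
       (∀ α : Π x : M, Cotangent I x, SmoothOneForm I α → ∀ x : M,
        lieOneForm I (fun y ↦ S.P y (α y)) S.ξ x = 0)) := by
  rw [S.isNormal_iff_torsion_eq_zero]
  simp only [(S.isParaContact_jet _).forall_torsion_eq_zero_iff, forall_and,
    S.forall_mlieBracket_P_eq_iff, S.forall_formBracket_P_comp_F_eq_iff,
    S.forall_nijenhuis_F_eq_iff, S.forall_lieOneForm_F_ξ_sub_eq_zero_iff,
    S.forall_extDerivTwo_σ_F_eq_iff, S.lieOneForm_Z_ξ_eq_zero_iff,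
    S.forall_lieBivector_Z_P_eq_zero_iff, S.forall_lieEndomorphism_Z_F_eq_zero_iff,
    S.forall_lieFlat_Z_σ_eq_zero_iff, S.forall_lieOneForm_P_ξ_eq_zero_iff]
  constructor
  · rintro ⟨h₁, h₂, h₃, h₄, h₄', h₅, h₆, h₇, h₈, h₉⟩
    exact ⟨h₁, ⟨S.F_P, h₂⟩, ⟨S.σ_Z, S.P_ξ, S.F_F, h₃⟩, ⟨S.F_Z, S.ξ_comp_F, h₄, h₄'⟩,
      h₅, h₆, h₇, h₈, h₉⟩
  · rintro ⟨h₁, ⟨-, h₂⟩, ⟨-, -, -, h₃⟩, ⟨-, -, h₄, h₄'⟩, h₅, h₆, h₇, h₈, h₉⟩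
    exact ⟨h₁, h₂, h₃, h₄, h₄', h₅, h₆, h₇, h₈, h₉⟩

open ParaContact in
theorem theorem3p1
    {E : Type*} [NormedAddCommGroup E] [NormedSpace ℝ E] [FiniteDimensional ℝ E]
    (hE : Odd (Module.finrank ℝ E))
    {M : Type*} [TopologicalSpace M] [T2Space M] [SecondCountableTopology M]
    [ChartedSpace E M] [IsManifold 𝓘(ℝ, E) ∞ M]
    (S : GenAlmostParaContact 𝓘(ℝ, E) M) :
    S.IsNormal ↔
      -- (A1)
      (∀ α β : Π x : M, Cotangent 𝓘(ℝ, E) x,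
        SmoothOneForm 𝓘(ℝ, E) α → SmoothOneForm 𝓘(ℝ, E) β → ∀ x : M,
        mlieBracket 𝓘(ℝ, E) (fun y ↦ S.P y (α y)) (fun y ↦ S.P y (β y)) x
          = S.P x (formBracket 𝓘(ℝ, E) S.P α β x)) ∧
      -- (A2)
      ((∀ (x : M) (α : Cotangent 𝓘(ℝ, E) x), S.F x (S.P x α) = S.P x (α.comp (S.F x))) ∧
       (∀ α β : Π x : M, Cotangent 𝓘(ℝ, E) x,
        SmoothOneForm 𝓘(ℝ, E) α → SmoothOneForm 𝓘(ℝ, E) β → ∀ x : M,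
        (formBracket 𝓘(ℝ, E) S.P α β x).comp (S.F x)
          = lieOneForm 𝓘(ℝ, E) (fun y ↦ S.P y (α y)) (fun y ↦ (β y).comp (S.F y)) x
            - lieOneForm 𝓘(ℝ, E) (fun y ↦ S.P y (β y)) (fun y ↦ (α y).comp (S.F y)) x
            + mvfderiv 𝓘(ℝ, E) (fun y ↦ ((α y).comp (S.F y)) (S.P y (β y))) x)) ∧
      -- (A3)
      ((∀ x : M, S.σ x (S.Z x) = 0) ∧
       (∀ x : M, S.P x (S.ξ x) = 0) ∧
       (∀ (x : M) (u : TangentSpace 𝓘(ℝ, E) x),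
        S.F x (S.F x u) = u - S.P x (S.σ x u) - S.ξ x u • S.Z x) ∧
       (∀ X Y : Π x : M, TangentSpace 𝓘(ℝ, E) x,
        SmoothVectorField 𝓘(ℝ, E) X → SmoothVectorField 𝓘(ℝ, E) Y → ∀ x : M,
        nijenhuis 𝓘(ℝ, E) S.F X Y x
          = S.P x (extDerivTwo 𝓘(ℝ, E) S.σ x (X x) (Y x))
            + extDerivOne 𝓘(ℝ, E) S.ξ x (X x) (Y x) • S.Z x)) ∧
      -- (A4)
      ((∀ x : M, S.F x (S.Z x) = 0) ∧
       (∀ x : M, (S.ξ x).comp (S.F x) = 0) ∧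
       (∀ X Y : Π x : M, TangentSpace 𝓘(ℝ, E) x,
        SmoothVectorField 𝓘(ℝ, E) X → SmoothVectorField 𝓘(ℝ, E) Y → ∀ x : M,
        lieOneForm 𝓘(ℝ, E) (fun y ↦ S.F y (X y)) S.ξ x (Y x)
          - lieOneForm 𝓘(ℝ, E) (fun y ↦ S.F y (Y y)) S.ξ x (X x) = 0) ∧
       (∀ (x : M) (u v w : TangentSpace 𝓘(ℝ, E) x),
        extDerivTwo 𝓘(ℝ, E) (fun y ↦ (S.σ y).comp (S.F y)) x u v w
          = extDerivTwo 𝓘(ℝ, E) S.σ x (S.F x u) v w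
            + extDerivTwo 𝓘(ℝ, E) S.σ x u (S.F x v) w
            + extDerivTwo 𝓘(ℝ, E) S.σ x u v (S.F x w))) ∧
      -- (A5)
      ((∀ x : M, lieOneForm 𝓘(ℝ, E) S.Z S.ξ x = 0) ∧
       (∀ α β : Π x : M, Cotangent 𝓘(ℝ, E) x,
        SmoothOneForm 𝓘(ℝ, E) α → SmoothOneForm 𝓘(ℝ, E) β → ∀ x : M,
        lieBivector 𝓘(ℝ, E) S.Z S.P α β x = 0) ∧
       (∀ X : Π x : M, TangentSpace 𝓘(ℝ, E) x, SmoothVectorField 𝓘(ℝ, E) X → ∀ x : M,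
        lieEndomorphism 𝓘(ℝ, E) S.Z S.F X x = 0) ∧
       (∀ X : Π x : M, TangentSpace 𝓘(ℝ, E) x, SmoothVectorField 𝓘(ℝ, E) X → ∀ x : M,
        lieFlat 𝓘(ℝ, E) S.Z S.σ X x = 0) ∧
       (∀ α : Π x : M, Cotangent 𝓘(ℝ, E) x, SmoothOneForm 𝓘(ℝ, E) α → ∀ x : M,
        lieOneForm 𝓘(ℝ, E) (fun y ↦ S.P y (α y)) S.ξ x = 0)) :=
  theorem3p1_general S
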